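/- For a letter $\ell\in\{0,1\}$ let $\overline{\ell}=1-\ell$, and let $\overline{W}$ be the word obtained from a finite word $W$ over $\{0,1\}$ by replacing each letter $\ell$ by $\overline{\ell}$. Let $A_0=0$ and $A_n=A_{n-1}\overline{A_{n-1}}$ for $n\ge 1$, and let $\mathbf t=\lim_{n\to\infty}A_n=0110100110010110\cdots$ be the Thue–Morse word. A word of length $kn$ is called a $k$-antipower if it has the form $w_1w_2\cdots w_k$ with pairwise distinct words $w_1,\dots,w_k$, each of length $n$. For $k\ge 1$ let $\mathcal F(k)$ be the set of odd positive integers $n$ such that the prefix of $\mathbf t$ of length $kn$ is a $k$-antipower. Let $\gamma(k)$ be the least element of $\mathcal F(k)$, and let $\Gamma(k)$ be the greatest odd positive integer that does not belong to $\mathcal F(k)$; the minimum $\gamma(k)$ exists for every $k\ge 1$ and the maximum $\Gamma(k)$ exists for every $k\ge 3$. Then $$\frac34\le\liminf_{k\to\infty}\frac{\gamma(k)}{k}\le\frac9{10},\qquad \limsup_{k\to\infty}\frac{\gamma(k)}{k}=\frac32,$$ $$\frac12\le\liminf_{k\to\infty}\frac{\Gamma(k)-\gamma(k)}{k}\le\frac34,\qquad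 \frac{11}6\le\limsup_{k\to\infty}\frac{\Gamma(k)-\gamma(k)}{k}\le\frac94.$$ In particular $\Gamma(k)-\gamma(k)$ grows linearly in $k$, that is, $\Gamma(k)-\gamma(k)=\Theta(k)$ as $k\to\infty$. -/

import Mathlib

open Filter Asymptotics

namespace ThueMorse

/-- The finite words `A 0 = 0` and `A (n + 1) = A n` followed by its complement, over the
alphabet `{0, 1}`, with `false` for `0` and `true` for `1`. -/
def A : ℕ → List Bool
  | 0 => [false]
  | n + 1 => A n ++ (A n).map not

theorem length_A (n : ℕ) : (A n).length = 2 ^ n := by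
  induction n with
  | zero => rfl
  | succ n ih => simp only [A, List.length_append, List.length_map, ih]; ring

/-- The letter `t n` (indexed from `0`) of the Thue–Morse word `t = lim A m`: it is read off
from `A n`, which has length `2 ^ n > n`. By `A_getElem?` every `A m` is the prefix of
length `2 ^ m` of `t`, so `t` is indeed the limit of the words `A m`. -/
def t (n : ℕ) : Bool :=
  (A n)[n]'(by rw [length_A]; exact Nat.lt_two_pow_self)

theorem A_prefix_of_le {m n : ℕ} (h : m ≤ n) : A m <+: A n := by
  induction n, h using Nat.le_induction with
  | base => exact List.prefix_rfl
  | succ n _ ih => exact ih.trans (List.prefix_append _ _)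

theorem A_getElem? {m n : ℕ} (h : n < 2 ^ m) : (A m)[n]? = some (t n) := by
  have hn : n < (A n).length := by rw [length_A]; exact Nat.lt_two_pow_self
  have hm : n < (A m).length := by rw [length_A]; exact h
  rw [List.getElem?_eq_getElem hm, t]
  rcases le_total m n with hmn | hmn
  · rw [(A_prefix_of_le hmn).getElem hm]
  · rw [(A_prefix_of_le hmn).getElem hn]

/-- A finite word `W` is a `k`-antipower if it is the concatenation of `k` pairwise distinct
words of the same length. -/
def IsAntipower {α : Type*} (k : ℕ) (W : List α) : Prop :=
  ∃ (n : ℕ) (w : Fin k → List α),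
    (∀ i, (w i).length = n) ∧ (∀ i j, i ≠ j → w i ≠ w j) ∧ W = (List.ofFn w).flatten

/-- The word formed by the first `m` letters of the infinite word `x`. -/
def firstLetters {α : Type*} (x : ℕ → α) (m : ℕ) : List α :=
  (List.range m).map x

/-- `AP x k` is the set of positive integers `n` such that the prefix of length `k * n` of `x`
is a `k`-antipower. -/
def AP {α : Type*} (x : ℕ → α) (k : ℕ) : Set ℕ :=
  {n | 0 < n ∧ IsAntipower k (firstLetters x (k * n))}

/-- The set of odd `n` such that the prefix of length `k * n` of the Thue–Morse word is a
`k`-antipower. -/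
def F (k : ℕ) : Set ℕ := AP t k ∩ {n | Odd n}

/-- `γ k` is the least element of `F k`. -/
noncomputable def γ (k : ℕ) : ℕ := sInf (F k)

/-- `Γ k` is the greatest odd positive integer that is not in `F k`. -/
noncomputable def Γ (k : ℕ) : ℕ := sSup ({n | Odd n} \ F k)

end ThueMorse

namespace ThueMorse

/-! Equality of blocks of odd length `n` is controlled from two sides. A factor of `t` longer than
`3 * 2 ^ s` recurs only at distances divisible by `2 ^ (s + 1)`; as `n` is odd, equal blocks `i`,
`j` with `3 * 2 ^ s < n` satisfy `2 ^ (s + 1) ∣ j - i` (`two_pow_dvd_of_blockEq`). This bounds `Γ k`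
by `3 * 2 ^ s` when `3 ≤ k ≤ 2 ^ (s + 1)`, and leaves few distances to examine in general.
Conversely, cut `t` into cells of length `2 ^ L`, each a fixed word or its complement. Passing from
block `i` to block `i + 2 ^ L` moves cell `a` to cell `a + n`, so the blocks agree exactly when `t a
= t (a + n)` on the few cells that meet block `i` (`blockEq_of_cells`, `cell_eq_of_blockEq`). The
rest is arithmetic of binary digits.

The hard half is the lower bound on `γ`: once `k` slightly exceeds `2 ^ j`, no odd `m` up to about
`3 / 2 * 2 ^ j` lies in `F k` (`exists_blockEq_lt`, `exists_forall_not_mem_F`). At such `k` this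
gives the ratio `3 / 2`; until the next threshold `k` doubles, which leaves `3 / 4`. The members `3
* 2 ^ c + 1`, `3 * 2 ^ r - 1` and `2 ^ j + 3` give the upper bounds `9 / 10` and `3 / 2`. Explicit
non-members bound `Γ` from below: numbers near `2 ^ (j + 1)` and `3 * 2 ^ j` yield `1 / 2`, while
`17 / 6 * 2 ^ j` against the member `2 ^ j - 3` yields `11 / 6`. -/

/-! ### Binary recursion for the letters of `t`. -/

theorem t_two_pow_add {k n : ℕ} (h : n < 2 ^ k) : t (2 ^ k + n) = !t n := by
  have h1 : 2 ^ k + n < 2 ^ (k + 1) := by rw [pow_succ]; omega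
  have h2 := A_getElem? h1
  rw [A, List.getElem?_append_right (by rw [length_A]; omega), length_A,
    Nat.add_sub_cancel_left, List.getElem?_map, A_getElem? h] at h2
  simpa using h2.symm

theorem t_zero : t 0 = false := rfl

theorem t_one : t 1 = true := rfl

theorem t_two_mul_aux (n : ℕ) : t (2 * n) = t n ∧ t (2 * n + 1) = !t n := by
  induction n using Nat.strong_induction_on with
  | _ n ih =>
    rcases Nat.eq_zero_or_pos n with rfl | hn
    · exact ⟨rfl, rfl⟩
    · have h1 : 2 ^ Nat.log 2 n ≤ n := Nat.pow_log_le_self 2 hn.ne'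
      have h2 : n < 2 ^ (Nat.log 2 n + 1) := Nat.lt_pow_succ_log_self (by norm_num) n
      obtain ⟨r, hr⟩ := Nat.exists_eq_add_of_le h1
      set k := Nat.log 2 n
      have hk : 0 < 2 ^ k := by positivity
      have hr' : r < 2 ^ k := by rw [pow_succ] at h2; omega
      obtain ⟨i1, i2⟩ := ih r (by omega)
      have e1 : 2 * n = 2 ^ (k + 1) + 2 * r := by rw [pow_succ]; omega
      have e2 : 2 * n + 1 = 2 ^ (k + 1) + (2 * r + 1) := by rw [pow_succ]; omega
      rw [e2, e1, t_two_pow_add (by rw [pow_succ]; omega), t_two_pow_add (by rw [pow_succ]; omega),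
        i1, i2, hr, t_two_pow_add hr']
      exact ⟨rfl, rfl⟩

theorem t_two_mul (n : ℕ) : t (2 * n) = t n := (t_two_mul_aux n).1

theorem t_two_mul_add_one (n : ℕ) : t (2 * n + 1) = !t n := (t_two_mul_aux n).2

theorem t_mul_two_pow_add (c a b : ℕ) (h : b < 2 ^ c) : t (a * 2 ^ c + b) = (t a ^^ t b) := by
  induction c generalizing b with
  | zero =>
    obtain rfl : b = 0 := by simpa using h
    simp [t_zero]
  | succ c ih =>
    rw [pow_succ] at h
    rcases Nat.even_or_odd' b with ⟨d, rfl | rfl⟩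
    · rw [show a * 2 ^ (c + 1) + 2 * d = 2 * (a * 2 ^ c + d) by ring, t_two_mul, t_two_mul,
        ih d (by omega)]
    · rw [show a * 2 ^ (c + 1) + (2 * d + 1) = 2 * (a * 2 ^ c + d) + 1 by ring,
        t_two_mul_add_one, t_two_mul_add_one, ih d (by omega)]
      cases t a <;> cases t d <;> rfl

/-! ### Distances between repeated factors. -/

/-- Three consecutive letters of the Thue–Morse word are never equal. -/
theorem t_not_cube (n : ℕ) : ¬ (t n = t (n + 1) ∧ t (n + 1) = t (n + 2)) := by
  rintro ⟨h1, h2⟩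
  rcases Nat.even_or_odd' n with ⟨d, rfl | rfl⟩
  · rw [t_two_mul, t_two_mul_add_one] at h1
    simp at h1
  · rw [show 2 * d + 1 + 1 = 2 * (d + 1) by ring, show 2 * d + 1 + 2 = 2 * (d + 1) + 1 by ring,
      t_two_mul, t_two_mul_add_one] at h2
    simp at h2

/-- Equal factors of length four never occur at an even and at an odd position. -/
theorem not_eq_four_of_even_odd (p q : ℕ) :
    ¬ (∀ u < 4, t (2 * p + u) = t (2 * q + 1 + u)) := by
  intro h
  have h0 := h 0 (by norm_num)
  have h1 := h 1 (by norm_num)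
  have h2 := h 2 (by norm_num)
  have h3 := h 3 (by norm_num)
  rw [add_zero, add_zero, t_two_mul, t_two_mul_add_one] at h0
  rw [show 2 * q + 1 + 1 = 2 * (q + 1) by ring, t_two_mul, t_two_mul_add_one] at h1
  rw [show 2 * q + 1 + 2 = 2 * (q + 1) + 1 by ring, show 2 * p + 2 = 2 * (p + 1) by ring,
    t_two_mul, t_two_mul_add_one] at h2
  rw [show 2 * q + 1 + 3 = 2 * (q + 2) by ring, show 2 * p + 3 = 2 * (p + 1) + 1 by ring,
    t_two_mul, t_two_mul_add_one] at h3
  apply t_not_cube q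
  revert h0 h1 h2 h3
  generalize t p = a; generalize t q = b; generalize t (p + 1) = c
  generalize t (q + 1) = d; generalize t (q + 2) = e
  revert a b c d e; decide

theorem even_add_of_eq_four {p q : ℕ} (h : ∀ u < 4, t (p + u) = t (q + u)) : p % 2 = q % 2 := by
  rcases Nat.even_or_odd' p with ⟨p', rfl | rfl⟩ <;> rcases Nat.even_or_odd' q with ⟨q', rfl | rfl⟩
  · omega
  · exact absurd h (not_eq_four_of_even_odd p' q')
  · exact absurd (fun u hu => (h u hu).symm) (not_eq_four_of_even_odd q' p')
  · omega

/-- Two occurrences of a factor of length greater than `3 * 2 ^ s` have distance divisible by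
`2 ^ (s + 1)`. -/
theorem two_pow_dvd_of_eq (s : ℕ) {p q : ℕ} (hpq : p ≤ q)
    (h : ∀ u ≤ 3 * 2 ^ s, t (p + u) = t (q + u)) : 2 ^ (s + 1) ∣ q - p := by
  induction s generalizing p q with
  | zero =>
    have := even_add_of_eq_four (p := p) (q := q) fun u hu => h u (by omega)
    omega
  | succ s ih =>
    have hpos : 0 < 2 ^ s := by positivity
    have h2 := even_add_of_eq_four (p := p) (q := q) fun u hu => h u (by rw [pow_succ]; omega)
    -- Once the two positions have the same parity, every second letter of the factor gives a
    -- repetition of half the length at half the distance.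
    have key : ∀ p' q', p' ≤ q' → (∀ u ≤ 3 * 2 ^ s, t (p' + u) = t (q' + u)) →
        q - p = 2 * (q' - p') → 2 ^ (s + 1 + 1) ∣ q - p := by
      intro p' q' hle hh he
      rw [he, pow_succ, mul_comm]
      exact Nat.mul_dvd_mul_left 2 (ih hle hh)
    rcases Nat.even_or_odd' p with ⟨p', rfl | rfl⟩ <;>
      rcases Nat.even_or_odd' q with ⟨q', rfl | rfl⟩
    · refine key p' q' (by omega) (fun u hu => ?_) (by omega)
      have := h (2 * u) (by rw [pow_succ]; omega)
      rwa [← mul_add, ← mul_add, t_two_mul, t_two_mul] at this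
    · omega
    · omega
    · refine key p' q' (by omega) (fun u hu => ?_) (by omega)
      have := h (2 * u) (by rw [pow_succ]; omega)
      rw [show 2 * p' + 1 + 2 * u = 2 * (p' + u) + 1 by ring,
        show 2 * q' + 1 + 2 * u = 2 * (q' + u) + 1 by ring, t_two_mul_add_one,
        t_two_mul_add_one] at this
      simpa using this

/-! ### Blocks and membership in `F`. -/

/-- The blocks with numbers `i` and `j` in the decomposition of `t` into blocks of length `n`
are equal. -/
def BlockEq (n i j : ℕ) : Prop := ∀ x < n, t (i * n + x) = t (j * n + x)

theorem flatten_ofFn_blocks (n k : ℕ) (x : ℕ → Bool) :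
    (List.ofFn fun i : Fin k => (List.range n).map fun y => x (i * n + y)).flatten =
      (List.range (k * n)).map x := by
  induction k with
  | zero => simp
  | succ k ih =>
    rw [List.ofFn_succ_last, List.flatten_append, Nat.succ_mul, List.range_add, List.map_append]
    simp only [Fin.val_castSucc, Fin.val_last, List.flatten_cons, List.flatten_nil,
      List.append_nil, List.map_map]
    rw [ih]
    rfl

/-- The length `k * n` of the prefix fixes the length of the factors, so the only candidate
decomposition is the one into blocks. -/
theorem mem_F_iff {k n : ℕ} :
    n ∈ F k ↔ Odd n ∧ ∀ i j, i < j → j < k → ¬ BlockEq n i j := by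
  constructor
  · rintro ⟨⟨hn, l, w, hl, hw, he⟩, hodd⟩
    refine ⟨hodd, fun i j hij hjk hB => ?_⟩
    have hlen := congrArg List.length he
    have hlf : (List.ofFn w).flatten.length = k * l := by
      rw [List.length_flatten, List.map_ofFn]
      simp [Function.comp_def, hl]
    rw [hlf] at hlen
    simp only [firstLetters, List.length_map, List.length_range] at hlen
    have hln : n = l := Nat.eq_of_mul_eq_mul_left (by omega) hlen
    subst hln
    rw [firstLetters, ← flatten_ofFn_blocks] at he
    have hww : (List.ofFn fun i : Fin k => (List.range n).map fun y => t (i * n + y)) =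
        List.ofFn w := by
      refine List.eq_iff_flatten_eq.mpr ⟨he, ?_⟩
      rw [List.map_ofFn, List.map_ofFn]
      congr 1
      funext i
      simp [hl]
    have hw' := List.ofFn_injective hww
    refine hw ⟨i, by omega⟩ ⟨j, hjk⟩ (by simpa using hij.ne) ?_
    rw [← hw']
    simp only
    refine List.map_congr_left fun x hx => hB x (List.mem_range.mp hx)
  · rintro ⟨hodd, h⟩
    refine ⟨⟨hodd.pos, n, fun i => (List.range n).map fun y => t (i * n + y), fun i => by simp,
      fun i j hij he => ?_, (flatten_ofFn_blocks n k t).symm⟩, hodd⟩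
    have hB : BlockEq n i j := fun x hx => by
      have := List.map_inj_left.mp he x (List.mem_range.mpr hx)
      exact this
    rcases lt_or_gt_of_ne (fun hh => hij (Fin.ext hh) : (i : ℕ) ≠ j) with hlt | hlt
    · exact h i j hlt j.2 hB
    · exact h j i hlt i.2 fun x hx => (hB x hx).symm

theorem not_mem_F_of_blockEq {k n i j : ℕ} (hij : i < j) (hj : j < k) (h : BlockEq n i j) :
    n ∉ F k := fun hn => (mem_F_iff.mp hn).2 i j hij hj h

theorem F_antitone {k l : ℕ} (h : k ≤ l) : F l ⊆ F k := fun n hn => by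
  rw [mem_F_iff] at hn ⊢
  exact ⟨hn.1, fun i j hij hj => hn.2 i j hij (hj.trans_le h)⟩

/-- For odd `n`, the distance of two equal blocks is divisible by a large power of two. -/
theorem two_pow_dvd_of_blockEq {s n i j : ℕ} (hn : Odd n) (hs : 3 * 2 ^ s < n) (hij : i ≤ j)
    (h : BlockEq n i j) : 2 ^ (s + 1) ∣ j - i := by
  have h1 := two_pow_dvd_of_eq s (p := i * n) (q := j * n) (Nat.mul_le_mul_right n hij)
    fun u hu => h u (by omega)
  rw [← Nat.sub_mul] at h1
  exact (Nat.Coprime.pow_left _ (Nat.coprime_two_left.mpr hn)).dvd_of_dvd_mul_right h1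

theorem mem_F_of_lt {s n : ℕ} (hn : Odd n) (hs : 3 * 2 ^ s < n) : n ∈ F (2 ^ (s + 1)) := by
  rw [mem_F_iff]
  refine ⟨hn, fun i j hij hj h => ?_⟩
  have := Nat.le_of_dvd (by omega) (two_pow_dvd_of_blockEq hn hs hij.le h)
  omega

/-! ### From blocks to cells. -/

/-- Blocks `i` and `i + 2 ^ L` of length `m` are equal if block `i` lies in the cells
`a, …, a + s - 1` of length `2 ^ L` and the cells agree with those `m` steps later. -/
theorem blockEq_of_cells {L m i a s : ℕ} (h1 : 2 ^ L * a ≤ i * m)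
    (h2 : i * m + m ≤ 2 ^ L * (a + s)) (h : ∀ u < s, t (a + u) = t (a + u + m)) :
    BlockEq m i (i + 2 ^ L) := by
  intro x hx
  have hL : 0 < 2 ^ L := by positivity
  set y := i * m + x with hy
  have e1 : y = (y / 2 ^ L) * 2 ^ L + y % 2 ^ L := (Nat.div_add_mod' _ _).symm
  have e2 : (i + 2 ^ L) * m + x = (y / 2 ^ L + m) * 2 ^ L + y % 2 ^ L := by
    have : (i + 2 ^ L) * m + x = y + m * 2 ^ L := by rw [hy]; ring
    rw [this]; nlinarith
  have hr : y % 2 ^ L < 2 ^ L := Nat.mod_lt _ hL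
  rw [e2, t_mul_two_pow_add _ _ _ hr]
  conv_lhs => rw [e1, t_mul_two_pow_add _ _ _ hr]
  have ha : a ≤ y / 2 ^ L := by
    rw [Nat.le_div_iff_mul_le hL]; nlinarith
  have hb : y / 2 ^ L < a + s := by
    rw [Nat.div_lt_iff_lt_mul hL]; nlinarith
  obtain ⟨u, hu⟩ := Nat.exists_eq_add_of_le ha
  rw [hu, h u (by omega)]

/-- If blocks `i` and `i + 2 ^ L` are equal, then all cells that meet block `i` agree with those
`m` steps later. -/
theorem cell_eq_of_blockEq {L m i a : ℕ} (h : BlockEq m i (i + 2 ^ L))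
    (h1 : i * m < 2 ^ L * (a + 1)) (h2 : 2 ^ L * a < i * m + m) : t a = t (a + m) := by
  have hL : 0 < 2 ^ L := by positivity
  have key : ∀ r x, r < 2 ^ L → i * m + x = a * 2 ^ L + r → x < m → t a = t (a + m) := by
    intro r x hr he hx
    have := h x hx
    rw [show (i + 2 ^ L) * m + x = (a + m) * 2 ^ L + r by
        rw [add_mul, add_mul, add_right_comm, he]; ring,
      he, t_mul_two_pow_add _ _ _ hr, t_mul_two_pow_add _ _ _ hr] at this
    simpa using this
  rcases le_total (i * m) (2 ^ L * a) with hle | hle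
  · exact key 0 (2 ^ L * a - i * m) hL (by rw [mul_comm a]; omega) (by omega)
  · exact key (i * m - 2 ^ L * a) 0 (by rw [mul_add, mul_one] at h1; omega)
      (by rw [mul_comm a]; omega) (Nat.pos_of_ne_zero fun hm => by subst hm; simp at h2)

/-! ### Three-letter agreements for arbitrary odd `m`. -/

/-- The parity of the `k` lowest binary digits of `n`, in a form that evaluates quickly. -/
def bitParity : ℕ → ℕ → Bool
  | 0, _ => false
  | k + 1, n => (n % 2 == 1) ^^ bitParity k (n / 2)

theorem t_eq_bitParity (k : ℕ) {n : ℕ} (h : n < 2 ^ k) : t n = bitParity k n := by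
  induction k generalizing n with
  | zero =>
    obtain rfl : n = 0 := by simpa using h
    rfl
  | succ k ih =>
    rw [pow_succ] at h
    rw [bitParity, ← ih (n := n / 2) (by omega)]
    rcases Nat.even_or_odd' n with ⟨d, rfl | rfl⟩
    · rw [t_two_mul]; simp
    · rw [t_two_mul_add_one]
      simp [Nat.add_mod, show (2 * d + 1) / 2 = d by omega]

/-- The letters `a`, `a + 1`, `a + 2` of `t` agree with those `m` steps later. -/
def Agree3 (m a : ℕ) : Prop := ∀ u < 3, t (a + u) = t (a + u + m)

/-- The first block starting at or after cell `a` starts fewer than `m` letters later, and two block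
lengths fit into three cells up to one letter. -/
theorem Agree3.exists_blockEq {m a L : ℕ} (h : Agree3 m a) (hm : 0 < m)
    (hL : 2 * m ≤ 3 * 2 ^ L + 1) : ∃ i, i * m < 2 ^ L * a + m ∧ BlockEq m i (i + 2 ^ L) := by
  have h1 : (2 ^ L * a + m - 1) / m * m ≤ 2 ^ L * a + m - 1 := Nat.div_mul_le_self _ _
  have h2 : 2 ^ L * a + m - 1 < ((2 ^ L * a + m - 1) / m + 1) * m :=
    Nat.lt_mul_of_div_lt (Nat.lt_succ_self _) hm
  rw [add_mul, one_mul] at h2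
  refine ⟨(2 ^ L * a + m - 1) / m, by omega, blockEq_of_cells (a := a) (s := 3) ?_ ?_ h⟩
  · omega
  · rw [mul_add]; omega

/-- Only `m % 64` matters: `v` and `w` stand for the unknown letters at `m / 64` and, after a carry,
at `m / 64 + 1`, and the search succeeds for all their values. -/
theorem exists_agree3_of_mod {m : ℕ} (hm : m % 2 = 1)
    (h : m % 32 ∉ [1, 3, 5, 11, 13, 19, 21, 27, 29, 31]) : ∃ a < 62, Agree3 m a := by
  have key : ∀ e < 64, e % 2 = 1 → e % 32 ∉ [1, 3, 5, 11, 13, 19, 21, 27, 29, 31] →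
      ∀ v w : Bool, ∃ a < 62, ∀ u < 3, bitParity 6 (a + u) =
        if a + u + e < 64 then v ^^ bitParity 6 (a + u + e)
          else w ^^ bitParity 6 (a + u + e - 64) := by
    decide +kernel
  obtain ⟨a, ha, hu⟩ := key (m % 64) (by omega) (by omega) (by rwa [Nat.mod_mod_of_dvd _ (by norm_num)])
    (t (m / 64)) (t (m / 64 + 1))
  refine ⟨a, ha, fun u hu3 => ?_⟩
  have h1 := hu u hu3
  rw [← t_eq_bitParity 6 (by omega)] at h1
  rw [h1]
  split_ifs with hc
  · rw [← t_eq_bitParity 6 hc, ← t_mul_two_pow_add 6 _ _ hc]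
    congr 1; omega
  · rw [← t_eq_bitParity 6 (by omega), ← t_mul_two_pow_add 6 _ _ (by omega)]
    congr 1; omega

/-- `t (ρ + u)` and `t (σ + u)` for `u < 3` are always equal (if `v` is `false`)
or always different (if `v` is `true`). -/
structure IsPattern (ρ σ : ℕ) (v : Bool) : Prop where
  le_left : ρ ≤ 15
  le_right : σ ≤ 15
  le_add_left : ρ ≤ σ + 13
  le_add_right : σ ≤ ρ + 13
  xor_eq : ∀ u < 3, (t (ρ + u) ^^ t (σ + u)) = v
  diff : v = false → σ = ρ + 3 ∨ ρ = σ + 3 ∨ σ = ρ + 5 ∨ ρ = σ + 5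

/-- These are the ten residues that `exists_agree3_of_mod` leaves. Here the low digits give an
agreement only up to a global complement `v`, to be compensated by higher digits. -/
theorem exists_pattern {m : ℕ} (hm : m % 32 ∈ [1, 3, 5, 11, 13, 19, 21, 27, 29, 31]) :
    ∃ ρ σ v, IsPattern ρ σ v ∧ (m + ρ) % 32 = σ := by
  have key : ∀ e ∈ [1, 3, 5, 11, 13, 19, 21, 27, 29, 31], ∃ ρ < 16, ∃ σ < 16, ∃ v : Bool,
      ((e + ρ) % 32 = σ ∧ ρ ≤ σ + 13 ∧ σ ≤ ρ + 13 ∧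
      (∀ u < 3, (bitParity 5 (ρ + u) ^^ bitParity 5 (σ + u)) = v) ∧
      (v = false → σ = ρ + 3 ∨ ρ = σ + 3 ∨ σ = ρ + 5 ∨ ρ = σ + 5)) := by
    decide +kernel
  obtain ⟨ρ, hρ, σ, hσ, v, h1, h2, h3, h5, h6⟩ := key _ hm
  refine ⟨ρ, σ, v, ⟨by omega, by omega, h2, h3, fun u hu => ?_, h6⟩, by omega⟩
  rw [t_eq_bitParity 5 (by omega), t_eq_bitParity 5 (by omega), h5 u hu]

/-- Adding `m` replaces the leading part `A` by `A + M` and the tail `ρ` by `σ`, with no carry into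
or out of `y`. The two effects cancel, and `y` stays free for later alignment. -/
theorem IsPattern.agree3 {ρ σ m M c A y : ℕ} {v : Bool} (h : IsPattern ρ σ v)
    (hm : m + ρ = M * 2 ^ c + σ) (hA : (t A ^^ t (A + M)) = v)
    (hy : 32 * y + 32 ≤ 2 ^ c) : Agree3 m (A * 2 ^ c + (32 * y + ρ)) := by
  intro u hu
  have h1 := h.le_left
  have h2 := h.le_right
  have h3 := h.xor_eq u hu
  rw [show A * 2 ^ c + (32 * y + ρ) + u + m = (A + M) * 2 ^ c + (y * 2 ^ 5 + (σ + u)) by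
      rw [add_mul]; omega,
    show A * 2 ^ c + (32 * y + ρ) + u = A * 2 ^ c + (y * 2 ^ 5 + (ρ + u)) by omega,
    t_mul_two_pow_add c _ _ (by omega), t_mul_two_pow_add c _ _ (by omega),
    t_mul_two_pow_add 5 _ _ (by omega), t_mul_two_pow_add 5 _ _ (by omega)]
  revert hA h3
  generalize t A = a; generalize t (A + M) = b; generalize t y = d
  generalize t (ρ + u) = x; generalize t (σ + u) = z
  clear h
  revert v a b d x z; decide

/-- For odd `M` the sequence `t A + t (A + M)` takes both values for `A ≤ 2`. -/
theorem exists_le_two_xor_eq {M : ℕ} (hM : Odd M) (v : Bool) :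
    ∃ A ≤ 2, (t A ^^ t (A + M)) = v := by
  by_contra! hcon
  obtain ⟨d, rfl⟩ := hM
  have h1 := hcon 1 (by norm_num)
  have h2 := hcon 2 (by norm_num)
  rw [show 1 + (2 * d + 1) = 2 * (d + 1) by ring, t_two_mul] at h1
  rw [show 2 + (2 * d + 1) = 2 * (d + 1) + 1 by ring, t_two_mul_add_one] at h2
  rw [show t 1 = true from rfl] at h1
  rw [show t 2 = true by rw [t_eq_bitParity 2 (by norm_num)]; rfl] at h2
  revert h1 h2
  generalize t (d + 1) = x
  clear hcon
  revert x v; decide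

/-! ### Aligning a block with three agreeing cells. -/

/-- Over two adjacent windows of `P + 1` indices the values `i * e` vary by at most `N`. If the
first window crosses a multiple of `N`, the second does not. -/
theorem exists_window_nat (N i₀ P e : ℕ) (hN : e * (2 * P + 1) ≤ N) (hN0 : 0 < N) :
    ∃ i₁, i₀ ≤ i₁ ∧ i₁ ≤ i₀ + P + 1 ∧ ∃ h : ℕ, N * h ≤ i₁ * e ∧ (i₁ + P) * e ≤ N * (h + 1) := by
  have h1 := Nat.div_add_mod (i₀ * e) N
  have h2 := Nat.mod_lt (i₀ * e) hN0
  set h := i₀ * e / N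
  by_cases hc : (i₀ + P) * e ≤ N * (h + 1)
  · exact ⟨i₀, le_rfl, by omega, h, by omega, hc⟩
  · refine ⟨i₀ + P + 1, by omega, le_rfl, h + 1, by nlinarith, by nlinarith⟩

/-- Among the multiples `i * e`, one finds long runs that do not cross a multiple of `N`. -/
theorem exists_window (N i₀ P : ℕ) (e : ℤ) (hN : |e| * (2 * P + 1) ≤ N) (hN0 : 0 < N) :
    ∃ i₁ : ℕ, i₀ ≤ i₁ ∧ i₁ ≤ i₀ + P + 1 ∧ ∃ h : ℤ, ∀ i : ℕ, i₁ ≤ i → i ≤ i₁ + P →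
      N * h ≤ i * e ∧ i * e ≤ N * (h + 1) := by
  obtain ⟨i₁, h1, h2, h, h3, h4⟩ := exists_window_nat N i₀ P e.natAbs
    (by zify; exact hN) hN0
  zify at h3 h4
  refine ⟨i₁, h1, h2, ?_⟩
  rcases le_total 0 e with he | he
  · rw [abs_of_nonneg he] at h3 h4
    refine ⟨h, fun i hi hi' => ?_⟩
    have a1 : (i₁ : ℤ) ≤ i := by exact_mod_cast hi
    have a2 : (i : ℤ) ≤ i₁ + P := by exact_mod_cast hi'
    constructor <;> nlinarith
  · rw [abs_of_nonpos he] at h3 h4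
    refine ⟨-(h + 1), fun i hi hi' => ?_⟩
    have a1 : (i₁ : ℤ) ≤ i := by exact_mod_cast hi
    have a2 : (i : ℤ) ≤ i₁ + P := by exact_mod_cast hi'
    constructor <;> nlinarith

theorem exists_mul_add_dvd (q M i₁ : ℕ) (hM : Odd M) (z : ℤ) :
    ∃ i : ℕ, i₁ ≤ i ∧ i < i₁ + 2 ^ q ∧ (2 ^ q : ℤ) ∣ i * M - z := by
  have hcop : IsCoprime (M : ℤ) (2 ^ q) := by
    rw [show ((2 : ℤ) ^ q) = ((2 ^ q : ℕ) : ℤ) by push_cast; rfl, Nat.isCoprime_iff_coprime]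
    exact (Nat.Coprime.pow_left _ (Nat.coprime_two_left.mpr hM)).symm
  obtain ⟨a, b, hab⟩ := hcop
  have hpos : (0 : ℤ) < 2 ^ q := by positivity
  have g1 := Int.emod_nonneg (a * z - i₁) hpos.ne'
  have g2 := Int.emod_lt_of_pos (a * z - i₁) hpos
  have g3 := Int.emod_add_mul_ediv (a * z - i₁) (2 ^ q)
  obtain ⟨r, hr⟩ := Int.eq_ofNat_of_zero_le g1
  refine ⟨i₁ + r, by omega, ?_, ?_⟩
  · zify
    omega
  · refine ⟨-b * z - (a * z - i₁) / 2 ^ q * M, ?_⟩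
    push_cast
    rw [hr] at g3
    have e1 : (r : ℤ) = (a * z - i₁) - 2 ^ q * ((a * z - i₁) / 2 ^ q) := by linarith
    rw [e1]
    linear_combination z * hab

-- Block `i` starts at `i * M * N + i * e`. In a window where `i * e` lies between `N * k` and `N *
-- (k + 1)`, it fits into three cells of length `Q * N` as soon as `i * M + k` is `Q` times an
-- agreeing cell number. That is a congruence modulo `32 * Q`, solvable because `M` is odd.
set_option maxHeartbeats 1000000 in
theorem IsPattern.exists_blockEq {ρ σ m M c A q : ℕ} {v : Bool} (h : IsPattern ρ σ v)
    (hm : m + ρ = M * 2 ^ c + σ) (hA : (t A ^^ t (A + M)) = v) (hA2 : A ≤ 2) (hM : Odd M)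
    (hMQ : 2 ^ q ≤ M) (hMQ' : M + 1 ≤ 3 * 2 ^ q) (hc : 1024 * 2 ^ q ≤ 2 ^ c) :
    ∃ i, i * M ≤ A * 2 ^ q * 2 ^ c + M * (96 * 2 ^ q + 40) ∧ BlockEq m i (i + 2 ^ (c + q)) := by
  set Q := 2 ^ q with hQ
  set N := 2 ^ c with hN
  have hQ1 : 1 ≤ Q := Nat.one_le_two_pow
  have hM1 : 1 ≤ M := hM.pos
  have hN1 : 1 ≤ N := Nat.one_le_two_pow
  set e : ℤ := (σ : ℤ) - ρ with he
  have he1 : |e| ≤ 13 := by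
    rw [abs_le]
    have := h.le_add_left; have := h.le_add_right
    omega
  -- The offset makes `y ≥ 0` below, even for the most negative possible `k`.
  set i₀ := A * Q * N / M + 32 * Q + 32 with hi₀
  obtain ⟨i₁, hi₁, hi₁', k, hk⟩ := exists_window N i₀ (32 * Q) e
    (by
      have h1 : |e| * (2 * (32 * (Q : ℤ)) + 1) ≤ 13 * (2 * (32 * Q) + 1) := by gcongr
      have h2 : (1024 : ℤ) * Q ≤ N := by exact_mod_cast hc
      have h3 : (1 : ℤ) ≤ Q := by exact_mod_cast hQ1
      push_cast
      linarith) hN1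
  obtain ⟨i, hi, hi', hdvd⟩ := exists_mul_add_dvd (q + 5) M i₁ hM (Q * ρ - k)
  rw [pow_add, ← hQ] at hi'
  have hd1 : A * Q * N / M * M ≤ A * Q * N := Nat.div_mul_le_self _ _
  have hd2 : A * Q * N < (A * Q * N / M + 1) * M := Nat.lt_mul_of_div_lt (Nat.lt_succ_self _) hM1
  have hup : i ≤ A * Q * N / M + 96 * Q + 40 := by omega
  have hiM : i * M ≤ A * Q * N + M * (96 * Q + 40) := by
    have := Nat.mul_le_mul_right M hup
    linarith
  have hiM' : A * Q * N + M * (32 * Q + 31) ≤ i * M := by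
    have : A * Q * N / M + 32 * Q + 32 ≤ i := by omega
    have := Nat.mul_le_mul_right M this
    linarith
  have hdiv : A * Q * N / M ≤ 2 * N := by
    rw [Nat.div_le_iff_le_mul_add_pred hM1]
    have : A * Q * N ≤ 2 * M * N := by gcongr
    rw [show M * (2 * N) = 2 * M * N by ring]
    omega
  have hi3 : i ≤ 3 * N := by omega
  obtain ⟨k1, k2⟩ := hk i hi (by omega)
  obtain ⟨k3, k4⟩ := hk (i + 1) (by omega) (by omega)
  have hkabs : |(i : ℤ) * e| ≤ 39 * N := by
    rw [abs_mul, abs_of_nonneg (by positivity : (0 : ℤ) ≤ i)]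
    have : (i : ℤ) ≤ 3 * N := by exact_mod_cast hi3
    calc (i : ℤ) * |e| ≤ 3 * N * 13 := by gcongr
      _ = 39 * N := by ring
  rw [abs_le] at hkabs
  have hNz : (1 : ℤ) ≤ N := by exact_mod_cast hN1
  have hk5 : k ≤ 39 := le_of_mul_le_mul_left (by linarith : (N : ℤ) * k ≤ N * 39) (by linarith)
  have hk6 : -39 ≤ k + 1 :=
    le_of_mul_le_mul_left (by linarith : (N : ℤ) * -39 ≤ N * (k + 1)) (by linarith)
  have hc5 : 2 ^ 5 ∣ N := by
    refine pow_dvd_pow 2 ?_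
    by_contra! hlt
    have : N ≤ 2 ^ 5 := Nat.pow_le_pow_right (by norm_num) hlt.le
    omega
  obtain ⟨N', hN'⟩ := hc5
  obtain ⟨y', hy'⟩ := hdvd
  have hQz : (1 : ℤ) ≤ Q := by exact_mod_cast hQ1
  have hMz : (1 : ℤ) ≤ M := by exact_mod_cast hM1
  have hMQz : (M : ℤ) + 1 ≤ 3 * Q := by exact_mod_cast hMQ'
  have hcz : (1024 : ℤ) * Q ≤ N := by exact_mod_cast hc
  have hiMz : (i : ℤ) * M ≤ A * Q * N + M * (96 * Q + 40) := by exact_mod_cast hiM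
  have hiMz' : (A : ℤ) * Q * N + M * (32 * Q + 31) ≤ i * M := by exact_mod_cast hiM'
  have hρ : (ρ : ℤ) ≤ 15 := by exact_mod_cast h.le_left
  have hρ0 : (0 : ℤ) ≤ ρ := by positivity
  have hQpow : (2 : ℤ) ^ (q + 5) = Q * 32 := by rw [pow_add, hQ]; push_cast; norm_num
  rw [hQpow] at hy'
  have hN'z : (N : ℤ) = 32 * N' := by rw [hN']; push_cast; ring
  -- the cell `a = A * N + 32 * y + ρ`
  have hy0 : 0 ≤ y' - A * N' := by
    by_contra! hcon
    have : (Q : ℤ) * 32 * y' ≤ Q * 32 * (A * N' - 1) := by gcongr; omega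
    rw [hN'z] at hiMz'
    have h1 : (Q : ℤ) * ρ ≤ Q * 15 := by gcongr
    have h2 : 1 * (32 * (Q : ℤ) + 31) ≤ M * (32 * Q + 31) := by gcongr
    linarith
  obtain ⟨y, hy⟩ := Int.eq_ofNat_of_zero_le hy0
  have hy2 : y' = A * N' + y := by linarith
  have ha : (i : ℤ) * M + k = Q * (A * N + (32 * y + ρ)) := by
    rw [hN'z]
    rw [hy2] at hy'
    linear_combination hy'
  have hy3 : 32 * y + 32 ≤ N := by
    by_contra! hcon
    have hcon' : (N : ℤ) + 1 ≤ 32 * y + 32 := by exact_mod_cast hcon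
    have : (Q : ℤ) * (A * N + (N - 31)) ≤ Q * (A * N + (32 * y + ρ)) := by gcongr; linarith
    have hMM : (M : ℤ) * (96 * Q + 40) ≤ (3 * Q) * (96 * Q + 40) := by gcongr; linarith
    have hQN : (Q : ℤ) * (1024 * Q) ≤ Q * N := by gcongr
    have hQQ : (Q : ℤ) * 1 ≤ Q * Q := by gcongr
    linarith
  have hagree := h.agree3 hm hA hy3
  have hmz : (m : ℤ) = M * N + e := by
    have : (m : ℤ) + ρ = M * N + σ := by exact_mod_cast hm
    linarith
  refine ⟨i, hiM, blockEq_of_cells (a := A * N + (32 * y + ρ)) (s := 3) ?_ ?_ hagree⟩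
  · zify
    rw [hmz, pow_add, show ((2 : ℤ) ^ c) = N by rw [hN]; push_cast; rfl,
      show ((2 : ℤ) ^ q) = Q by rw [hQ]; push_cast; rfl, mul_assoc, ← ha]
    linarith
  · zify
    rw [hmz, pow_add, show ((2 : ℤ) ^ c) = N by rw [hN]; push_cast; rfl,
      show ((2 : ℤ) ^ q) = Q by rw [hQ]; push_cast; rfl, mul_assoc, mul_add (Q : ℤ), ← ha]
    push_cast at k4
    have hNM : (N : ℤ) * (M + 1) ≤ N * (3 * Q) := by gcongr
    linarith

/-! ### Equal blocks for `m` within 5 of a power of two. -/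

theorem isPattern_three : IsPattern 11 14 false := by
  refine ⟨by norm_num, by norm_num, by norm_num, by norm_num, fun u hu => ?_,
    fun _ => by norm_num⟩
  rw [t_eq_bitParity 5 (by omega), t_eq_bitParity 5 (by omega)]
  revert u; decide

theorem isPattern_neg_three : IsPattern 14 11 false := by
  refine ⟨by norm_num, by norm_num, by norm_num, by norm_num, fun u hu => ?_,
    fun _ => by norm_num⟩
  rw [t_eq_bitParity 5 (by omega), t_eq_bitParity 5 (by omega)]
  revert u; decide

theorem t_one_xor_t_two : (t 1 ^^ t (1 + 1)) = false := by
  rw [t_eq_bitParity 2 (by norm_num), t_eq_bitParity 2 (by norm_num)]; rfl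

/-- The agreeing cells are `2 ^ (k + 1) + 11` and the next two; block `2 ^ k + 4` starts 12 letters
into the first of them. -/
theorem blockEq_two_pow_add_three {k m : ℕ} (hk : 5 ≤ k) (hm : m = 2 ^ (k + 1) + 3) :
    BlockEq m (2 ^ k + 4) (2 ^ k + 4 + 2 ^ k) := by
  have h32 : 2 ^ 5 ≤ 2 ^ k := Nat.pow_le_pow_right (by norm_num) hk
  have hag := isPattern_three.agree3 (m := m) (M := 1) (c := k + 1) (A := 1) (y := 0) (by omega)
    t_one_xor_t_two (by rw [pow_succ]; omega)
  refine blockEq_of_cells (s := 3) ?_ ?_ hag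
  · rw [hm, pow_succ]; nlinarith
  · rw [hm, pow_succ]; nlinarith

theorem blockEq_two_pow_sub_three {k m : ℕ} (hk : 5 ≤ k) (hm : m + 3 = 2 ^ (k + 1)) :
    BlockEq m (2 ^ k + 9) (2 ^ k + 9 + 2 ^ k) := by
  have h32 : 2 ^ 5 ≤ 2 ^ k := Nat.pow_le_pow_right (by norm_num) hk
  have hag := isPattern_neg_three.agree3 (m := m) (M := 1) (c := k + 1) (A := 1) (y := 0)
    (by omega) t_one_xor_t_two (by rw [pow_succ]; omega)
  rw [pow_succ] at hm
  refine blockEq_of_cells (s := 3) ?_ ?_ hag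
  · rw [pow_succ]; nlinarith
  · rw [pow_succ]; nlinarith

theorem blockEq_two_pow_add_five {k m : ℕ} (hk : 5 ≤ k) (hm : m = 2 ^ k + 5) :
    BlockEq m 3 (3 + 2 ^ k) := by
  have h32 : 2 ^ 5 ≤ 2 ^ k := Nat.pow_le_pow_right (by norm_num) hk
  refine blockEq_of_cells (a := 3) (s := 2) (by omega) (by omega) fun u hu => ?_
  rw [show 3 + u + m = 2 ^ k + (8 + u) by omega, t_two_pow_add (by omega),
    t_eq_bitParity 4 (by omega), t_eq_bitParity 4 (by omega)]
  clear hm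
  revert u; decide

theorem blockEq_two_pow_sub_five {k m : ℕ} (hk : 6 ≤ k) (hm : m + 5 = 2 ^ k) :
    BlockEq m 9 (9 + 2 ^ k) := by
  have h32 : 2 ^ 6 ≤ 2 ^ k := Nat.pow_le_pow_right (by norm_num) hk
  refine blockEq_of_cells (a := 8) (s := 2) (by omega) (by omega) fun u hu => ?_
  rw [show 8 + u + m = 2 ^ k + (3 + u) by omega, t_two_pow_add (by omega),
    t_eq_bitParity 4 (by omega), t_eq_bitParity 4 (by omega)]
  clear hm
  revert u; decide

/-! ### Small odd numbers are not in `F`. -/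

/-- If `m` is odd and slightly less than `3 / 2 * 2 ^ (p + C)` and more than half of that, then
two of the first `2 ^ (p + C) + 2 ^ (p + 4)` blocks of length `m` are equal. -/
theorem exists_blockEq_lt {C p m : ℕ} (hC : 3 ≤ C) (hp : C + 12 ≤ p) (hm : Odd m)
    (h1 : 3 * 2 ^ (p + C) ≤ 4 * (m + 2 ^ p)) (h2 : 2 * (m + 2 ^ p) ≤ 3 * 2 ^ (p + C)) :
    ∃ i j, i < j ∧ j < 2 ^ (p + C) + 2 ^ (p + 4) ∧ BlockEq m i j := by
  have hp15 : 2 ^ 15 ≤ 2 ^ p := Nat.pow_le_pow_right (by norm_num) (by omega)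
  have hp4 : 2 ^ (p + 4) = 16 * 2 ^ p := by rw [pow_add]; ring
  have hPJ : 8 * 2 ^ p ≤ 2 ^ (p + C) := by
    rw [pow_add, mul_comm]
    exact Nat.mul_le_mul_left _ (Nat.pow_le_pow_right (n := 2) (by norm_num) hC)
  -- Since `2 ^ (p + C) ≤ 2 * m`, an agreement at cell `a` yields a block number at most `2 * a`,
  -- well below `2 ^ (p + 4)`.
  have small : ∀ a, a ≤ 3 * 2 ^ p → Agree3 m a →
      ∃ i j, i < j ∧ j < 2 ^ (p + C) + 2 ^ (p + 4) ∧ BlockEq m i j := by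
    intro a ha hag
    obtain ⟨i, hi, hB⟩ := hag.exists_blockEq (L := p + C) (by omega) (by omega)
    have hlt : i * m < (2 * a + 1) * m := by
      have : 2 ^ (p + C) * a ≤ 2 * m * a := by gcongr; omega
      linarith
    have := Nat.lt_of_mul_lt_mul_right hlt
    exact ⟨i, _, by omega, by omega, hB⟩
  by_cases hmod : m % 32 ∈ [1, 3, 5, 11, 13, 19, 21, 27, 29, 31]
  swap
  · obtain ⟨a, ha, hag⟩ := exists_agree3_of_mod (Nat.odd_iff.mp hm) hmod
    exact small a (by omega) hag
  obtain ⟨ρ, σ, v, hpat, hρ⟩ := exists_pattern hmod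
  have hb1 := hpat.le_add_left
  have hb2 := hpat.le_add_right
  have hb3 := hpat.le_left
  obtain ⟨k, M, hM, hkM⟩ := Nat.exists_eq_two_pow_mul_odd (n := (m + ρ) / 32) (by omega)
  have hrep : m + ρ = M * 2 ^ (k + 5) + σ := by
    have := Nat.div_add_mod (m + ρ) 32
    rw [hkM, hρ] at this
    rw [← this, pow_add]; ring
  have hc5 : 5 ≤ k + 5 := by omega
  generalize k + 5 = c at hrep hc5
  have h32 : 2 ^ 5 ≤ 2 ^ c := Nat.pow_le_pow_right (by norm_num) hc5
  by_cases h0 : (t 0 ^^ t (0 + M)) = v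
  · refine small _ ?_ (hpat.agree3 (y := 0) hrep h0 (by omega))
    omega
  obtain ⟨A, hA2, hA⟩ := exists_le_two_xor_eq hM v
  by_cases hcp : c ≤ p
  · refine small _ ?_ (hpat.agree3 (y := 0) hrep hA (by omega))
    have : 2 ^ c ≤ 2 ^ p := Nat.pow_le_pow_right (by norm_num) hcp
    have : A * 2 ^ c ≤ 2 * 2 ^ p := by gcongr
    omega
  have hM1 := hM.pos
  rcases lt_trichotomy c (p + C) with hcJ | hcJ | hcJ
  -- The agreement may now start too far out for distance `2 ^ (p + C)`. Half that distance leaves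
  -- room for `i` up to `2 ^ (p + C - 1)`, but three cells may then barely hold a block, whence the
  -- alignment lemma.
  · obtain ⟨q, hq⟩ : ∃ q, p + C = c + q + 1 := ⟨p + C - c - 1, by omega⟩
    have hJ : 2 ^ (p + C) = 2 * (2 ^ q * 2 ^ c) := by rw [hq, pow_succ, pow_add]; ring
    have hMQ : 2 ^ q ≤ M := by
      refine Nat.le_of_mul_le_mul_right (c := 2 ^ c) ?_ (by positivity)
      omega
    have hMQ' : M < 3 * 2 ^ q := by
      refine Nat.lt_of_mul_lt_mul_right (a := 2 ^ c) ?_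
      rw [mul_assoc]
      omega
    rcases Nat.eq_zero_or_pos q with rfl | hq0
    · have : M = 1 := by
        have := Nat.odd_iff.mp hM
        omega
      subst this
      omega
    have hM3 : 3 ≤ M := by
      have : 2 ^ 1 ≤ 2 ^ q := Nat.pow_le_pow_right (by norm_num) hq0
      have := Nat.odd_iff.mp hM
      omega
    have hbig : 1024 * 2 ^ q ≤ 2 ^ c := by
      rw [show 1024 = 2 ^ 10 by norm_num, ← pow_add]
      exact Nat.pow_le_pow_right (by norm_num) (by omega)
    obtain ⟨i, hi, hB⟩ := hpat.exists_blockEq hrep hA hA2 hM hMQ hMQ' hbig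
    refine ⟨i, _, Nat.lt_add_of_pos_right (by positivity), ?_, hB⟩
    have hL : 2 ^ (c + q) = 2 ^ q * 2 ^ c := by rw [pow_add, mul_comm]
    have hQ1 : 1 ≤ 2 ^ q := Nat.one_le_two_pow
    rw [hL, hJ]
    suffices i ≤ 2 ^ q * 2 ^ c by omega
    by_contra! hcon
    have e1 : 2 ^ q * 2 ^ c * M ≤ i * M := Nat.mul_le_mul_right M hcon.le
    have e2 : A * 2 ^ q * 2 ^ c ≤ 2 * 2 ^ q * 2 ^ c := by gcongr
    have e3 : 2 ^ q * (1024 * 2 ^ q) ≤ 2 ^ q * 2 ^ c := Nat.mul_le_mul_left _ hbig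
    have e4 : 2 ^ q * 1 ≤ 2 ^ q * 2 ^ q := Nat.mul_le_mul_left _ hQ1
    have e5 : M * (96 * 2 ^ q + 40) * 3 ≤ M * (2 ^ q * 2 ^ c) := by
      rw [mul_assoc]
      refine Nat.mul_le_mul_left _ ?_
      linarith
    have e6 : 3 * (2 ^ q * 2 ^ c) ≤ M * (2 ^ q * 2 ^ c) := Nat.mul_le_mul_right _ hM3
    have e7 : 0 < 2 ^ q * 2 ^ c := by positivity
    nlinarith
  · have hM' : M = 1 := by
      have hcJ' : 2 ^ c = 2 ^ (p + C) := by rw [hcJ]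
      have : M * 2 ^ c < 2 * 2 ^ c := by omega
      have := Nat.lt_of_mul_lt_mul_right this
      omega
    subst hM'
    -- Since `t 0 ≠ t 1`, the value `v = true` was settled by `A = 0`; so `m` differs from `2 ^ (p +
    -- C)` by 3 or 5.
    have hv : v = false := by
      cases v
      · rfl
      · exact absurd rfl h0
    rw [hcJ] at hrep
    obtain ⟨J, hJ⟩ : ∃ J, p + C = J + 1 := ⟨p + C - 1, by omega⟩
    have hJ2 : 2 ^ (p + C) = 2 * 2 ^ J := by rw [hJ, pow_succ]; ring
    have hJp : 0 < 2 ^ J := by positivity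
    rcases hpat.diff hv with hd | hd | hd | hd
    · exact ⟨_, _, by omega, by omega, blockEq_two_pow_add_three (k := J) (by omega)
        (by rw [← hJ]; omega)⟩
    · exact ⟨_, _, by omega, by omega, blockEq_two_pow_sub_three (k := J) (by omega)
        (by rw [← hJ]; omega)⟩
    · exact ⟨_, _, by omega, by omega, blockEq_two_pow_add_five (k := p + C) (by omega)
        (by omega)⟩
    · exact ⟨_, _, by omega, by omega, blockEq_two_pow_sub_five (k := p + C) (by omega)
        (by omega)⟩
  · exfalso
    have e1 : 2 ^ (p + C + 1) ≤ 2 ^ c := Nat.pow_le_pow_right (by norm_num) hcJ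
    have e2 : 1 * 2 ^ c ≤ M * 2 ^ c := Nat.mul_le_mul_right _ hM1
    rw [pow_succ] at e1
    omega

/-- The digits of `m` occur twice in front of those of `x`, so their parities cancel. This disposes
of bounded `m`. -/
theorem blockEq_zero (m : ℕ) : BlockEq m 0 (2 ^ m * (2 ^ m + 1)) := by
  intro x hx
  have h1 : x < 2 ^ m := hx.trans Nat.lt_two_pow_self
  rw [zero_mul, zero_add, show 2 ^ m * (2 ^ m + 1) * m + x = (m * 2 ^ m + m) * 2 ^ m + x by ring,
    t_mul_two_pow_add _ _ _ h1, t_mul_two_pow_add _ _ _ Nat.lt_two_pow_self]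
  simp

/-- For large `p`, no odd `m` up to about `3 / 2 * 2 ^ (p + C)` is in
`F (2 ^ (p + C) + 2 ^ (p + 4))`. -/
theorem exists_forall_not_mem_F {C : ℕ} (hC : 3 ≤ C) : ∃ P, ∀ p ≥ P, ∀ m, Odd m →
    2 * (m + 2 ^ p) ≤ 3 * 2 ^ (p + C) → m ∉ F (2 ^ (p + C) + 2 ^ (p + 4)) := by
  set m₀ := 2 ^ (C + 12 + C + 1) with hm₀
  refine ⟨C + 12 + (2 * m₀ + 2), fun p hp m hm hle => ?_⟩
  -- The ranges of `exists_blockEq_lt` at consecutive scales overlap: failing the upper bound at `q`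
  -- implies the lower bound at `q + 1`.
  have key : ∀ q ≥ C + 12, 2 * (m + 2 ^ q) ≤ 3 * 2 ^ (q + C) → m ≤ m₀ ∨
      ∃ q' ≤ q, C + 12 ≤ q' ∧ 3 * 2 ^ (q' + C) ≤ 4 * (m + 2 ^ q') ∧
        2 * (m + 2 ^ q') ≤ 3 * 2 ^ (q' + C) := by
    intro q hq
    induction q, hq using Nat.le_induction with
    | base =>
      intro h
      have : 0 < 2 ^ (C + 12) := by positivity
      left; rw [hm₀, pow_succ]; omega
    | succ q hq ih =>
      intro h
      by_cases h' : 2 * (m + 2 ^ q) ≤ 3 * 2 ^ (q + C)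
      · obtain h1 | ⟨q', h1, h2⟩ := ih h'
        · exact Or.inl h1
        · exact Or.inr ⟨q', by omega, h2⟩
      · refine Or.inr ⟨q + 1, le_rfl, by omega, ?_, h⟩
        rw [show q + 1 + C = q + C + 1 by ring, pow_succ, pow_succ]
        omega
  obtain hsmall | ⟨q, hq, hq', h1, h2⟩ := key p (by omega) hle
  · refine not_mem_F_of_blockEq (by positivity) ?_ (blockEq_zero m)
    have e1 : 2 ^ m ≤ 2 ^ m₀ := Nat.pow_le_pow_right (by norm_num) hsmall
    have e2 : 2 ^ (2 * m₀ + 2) ≤ 2 ^ (p + C) := Nat.pow_le_pow_right (by norm_num) (by omega)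
    have e3 : 2 ^ (2 * m₀ + 2) = 4 * (2 ^ m₀ * 2 ^ m₀) := by
      rw [pow_add, two_mul, pow_add]; ring
    have e4 : 2 ^ m * (2 ^ m + 1) ≤ 2 * (2 ^ m₀ * 2 ^ m₀) := by
      calc 2 ^ m * (2 ^ m + 1) ≤ 2 ^ m₀ * (2 ^ m₀ + 2 ^ m₀) := by
            gcongr; exact Nat.one_le_two_pow
        _ = 2 * (2 ^ m₀ * 2 ^ m₀) := by ring
    have e5 : 0 < 2 ^ (p + 4) := by positivity
    rw [e3] at e2
    exact e4.trans_lt (by omega)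
  · obtain ⟨i, j, hij, hj, hB⟩ := exists_blockEq_lt hC hq' hm h1 h2
    refine not_mem_F_of_blockEq hij (hj.trans_le ?_) hB
    have e1 : 2 ^ (q + C) ≤ 2 ^ (p + C) := Nat.pow_le_pow_right (by norm_num) (by omega)
    have e2 : 2 ^ (q + 4) ≤ 2 ^ (p + 4) := Nat.pow_le_pow_right (by norm_num) (by omega)
    omega

/-! ### Explicit numbers outside `F`, for lower bounds on `Γ`. -/

theorem t_two_pow_sub_one (n : ℕ) : t (2 ^ n - 1) = (n % 2 == 1) := by
  induction n with
  | zero => rfl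
  | succ n ih =>
    have : 0 < 2 ^ n := by positivity
    rw [show 2 ^ (n + 1) - 1 = 2 * (2 ^ n - 1) + 1 by rw [pow_succ]; omega, t_two_mul_add_one, ih]
    rcases Nat.mod_two_eq_zero_or_one n with h | h
    · simp [h, Nat.add_mod]
    · simp [h, Nat.add_mod]

theorem t_eight_mul_add (w r : ℕ) (hr : r < 8) : t (8 * w + r) = (t w ^^ bitParity 3 r) := by
  rw [show 8 * w + r = w * 2 ^ 3 + r by ring, t_mul_two_pow_add 3 _ _ hr, t_eq_bitParity 3 hr]

/-- Block `0` lies in cells `0` and `1`, so it suffices that `t` reads `01` at `m`; the parity of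
`j` decides which candidate does. -/
theorem two_pow_not_mem_F {j m : ℕ} (hj : 3 ≤ j)
    (hm : m + 1 = 2 ^ (j + 1) ∧ j % 2 = 1 ∨ m + 5 = 2 ^ (j + 1) ∧ j % 2 = 0) :
    m ∉ F (2 ^ j + 1) := by
  obtain ⟨k, rfl⟩ := Nat.exists_eq_add_of_le' hj
  have hw : 2 ^ (k + 3) = 8 * 2 ^ k := by rw [pow_add]; ring
  have hw' : 2 ^ (k + 3 + 1) = 8 * 2 ^ (k + 1) := by rw [pow_add, pow_add, pow_add]; ring
  have hpos : 0 < 2 ^ (k + 1) := by positivity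
  have hp1 := t_two_pow_sub_one (k + 1)
  have hlt : m ≤ 2 ^ (k + 3) * 2 := by rw [← pow_succ]; omega
  refine not_mem_F_of_blockEq (i := 0) (j := 0 + 2 ^ (k + 3)) (by positivity) (by omega)
    (blockEq_of_cells (a := 0) (s := 2) (by simp) (by simpa using hlt) fun u hu => ?_)
  rcases hm with ⟨hm, hpar⟩ | ⟨hm, hpar⟩
  · have hkp : (k + 1) % 2 = 1 := by omega
    rw [hkp] at hp1
    interval_cases u
    · rw [show 0 + 0 + m = 8 * (2 ^ (k + 1) - 1) + 7 by omega, t_eight_mul_add _ _ (by norm_num), hp1]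
      rfl
    · rw [show 0 + 1 + m = 2 ^ (k + 3 + 1) + 0 by omega, t_two_pow_add (by positivity)]
      rfl
  · have hkp : (k + 1) % 2 = 0 := by omega
    rw [hkp] at hp1
    interval_cases u
    · rw [show 0 + 0 + m = 8 * (2 ^ (k + 1) - 1) + 3 by omega, t_eight_mul_add _ _ (by norm_num), hp1]
      rfl
    · rw [show 0 + 1 + m = 8 * (2 ^ (k + 1) - 1) + 4 by omega, t_eight_mul_add _ _ (by norm_num), hp1]
      rfl

/-- A number close to `3 * 2 ^ (p + s)` that is not in `F k` for `k` little more
than `2 ^ (p + s)`. -/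
theorem three_mul_two_pow_sub_not_mem_F {p s m : ℕ} (hs : 4 ≤ s) (hs2 : s % 2 = 0)
    (hp : s + 3 ≤ p) (hm : m + 2 ^ p + 1 = 3 * 2 ^ (p + s)) :
    m ∉ F (2 ^ (p + s) + 2 ^ (s + 1)) := by
  set S := 2 ^ s with hS
  set P := 2 ^ p with hP
  have hPS : 2 ^ (p + s) = S * P := by rw [pow_add, mul_comm]
  have h8 : 8 * S ≤ P := by
    rw [hS, hP, show 8 = 2 ^ 3 by norm_num, ← pow_add]
    exact Nat.pow_le_pow_right (by norm_num) (by omega)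
  obtain ⟨s', rfl⟩ := Nat.exists_eq_add_of_le' hs
  have hS' : S = 16 * 2 ^ s' := by rw [hS, pow_add]; ring
  have hpos : 0 < 2 ^ s' := by positivity
  have hSS : 2 ^ (s' + 4 + 1) = 2 * S := by rw [hS, pow_succ _ (s' + 4)]; ring
  rw [hSS, hPS]
  rw [hPS] at hm
  -- Adding `m` shifts back by one under the leading part `3 * S - 1`, whose digit sum is odd.
  -- Agreement thus means alternation, which holds at letters 2 to 5 of a group of eight.
  have hag : ∀ u < 3, t (6 * S - 5 + u) = t (6 * S - 5 + u + m) := by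
    intro u hu
    have h1 : t (3 * S - 1) = true := by
      rw [show 3 * S - 1 = 2 * 2 ^ (s' + 4) + (S - 1) by omega,
        t_mul_two_pow_add _ _ _ (by omega), hS, t_two_pow_sub_one, hs2]
      rfl
    have h2 : 6 * S - 5 + u + m = (3 * S - 1) * P + (6 * S - 6 + u) := by
      rw [Nat.sub_mul, mul_assoc]
      have : P ≤ 3 * (S * P) := by nlinarith
      omega
    rw [h2, t_mul_two_pow_add _ _ _ (by omega), h1,
      show 6 * S - 5 + u = 8 * (12 * 2 ^ s' - 1) + (3 + u) by omega,
      show 6 * S - 6 + u = 8 * (12 * 2 ^ s' - 1) + (2 + u) by omega,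
      t_eight_mul_add _ _ (by omega), t_eight_mul_add _ _ (by omega)]
    generalize t (12 * 2 ^ s' - 1) = x
    clear h2 hm hs2
    revert u x; decide
  have hle : 2 * S - 1 < 2 * S := by omega
  -- This block ends `2 * S` letters before the boundary of cell `6 * S - 2`, so it fits into three
  -- cells.
  refine not_mem_F_of_blockEq (i := 2 * S - 1) (j := 2 * S - 1 + 2 ^ (p + (s' + 4)))
    (by have : 0 < 2 ^ (p + (s' + 4)) := by positivity
        omega) (by omega)
    (blockEq_of_cells (a := 6 * S - 5) (s := 3) ?_ ?_ hag)
  · rw [hPS]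
    zify [show 5 ≤ 6 * S by omega, show 1 ≤ 2 * S by omega] at hm ⊢
    have : (m : ℤ) = 3 * (S * P) - P - 1 := by linarith
    rw [this]
    have : (8 : ℤ) * S ≤ P := by exact_mod_cast h8
    nlinarith
  · rw [hPS, show 6 * S - 5 + 3 = 6 * S - 2 by omega]
    zify [show 2 ≤ 6 * S by omega, show 1 ≤ 2 * S by omega] at hm ⊢
    have : (m : ℤ) = 3 * (S * P) - P - 1 := by linarith
    rw [this]
    nlinarith

/-- Block `5` ends at `6 * m = 17 * 2 ^ (4 * n + 10) - 2`, just inside the cells 14, 15, 16; this is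
the origin of `17 / 6`. -/
theorem exists_seventeen_sixths (n : ℕ) :
    ∃ m, 6 * m + 2 = 17 * 2 ^ (4 * n + 10) ∧ m ∉ F (2 ^ (4 * n + 10) + 6) ∧ Odd m := by
  -- Appending the digits 0101 to `U` multiplies `3 * U + 1` by 16 and keeps the digit parity.
  have hU : ∃ U, 3 * U + 1 = 17 * 2 ^ (4 * n + 3) ∧ t U = false := by
    induction n with
    | zero => exact ⟨45, by norm_num, by rw [t_eq_bitParity 6 (by norm_num)]; rfl⟩
    | succ n ih =>
      obtain ⟨U, h1, h2⟩ := ih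
      refine ⟨U * 2 ^ 4 + 5, ?_, ?_⟩
      · rw [show 4 * (n + 1) + 3 = 4 * n + 3 + 4 by ring, pow_add]
        omega
      · rw [t_mul_two_pow_add 4 _ _ (by norm_num), h2, t_eq_bitParity 3 (by norm_num)]
        rfl
  obtain ⟨U, h1, h2⟩ := hU
  have h3 : 2 ^ (4 * n + 10) = 128 * 2 ^ (4 * n + 3) := by
    rw [show 4 * n + 10 = 4 * n + 3 + 7 by ring, pow_add]; ring
  refine ⟨U * 2 ^ 6 + 21, by omega, ?_, by rw [Nat.odd_iff]; omega⟩
  refine not_mem_F_of_blockEq (i := 5) (j := 5 + 2 ^ (4 * n + 10))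
    (by omega) (by omega) (blockEq_of_cells (a := 14) (s := 3) (by omega) (by omega) fun u hu => ?_)
  rw [show 14 + u + (U * 2 ^ 6 + 21) = U * 2 ^ 6 + (35 + u) by ring,
    t_mul_two_pow_add 6 _ _ (by omega), h2, t_eq_bitParity 6 (by omega),
    t_eq_bitParity 6 (by omega)]
  clear h1 h2 h3
  revert u; decide

/-! ### Explicit members of `F`, for upper bounds on `γ`. -/

theorem t_ne_succ (n : ℕ) : t (2 * n) ≠ t (2 * n + 1) := by
  rw [t_two_mul, t_two_mul_add_one]; simp

theorem t_four_mul_add (w r : ℕ) (hr : r < 4) : t (4 * w + r) = (t w ^^ bitParity 2 r) := by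
  rw [show 4 * w + r = w * 2 ^ 2 + r by ring, t_mul_two_pow_add 2 _ _ hr, t_eq_bitParity 2 hr]

theorem t_three_mul_two_pow_add {c x : ℕ} (hx : x < 2 ^ c) : t (3 * 2 ^ c + x) = t x := by
  rw [t_mul_two_pow_add _ _ _ hx, show t 3 = false by rw [t_eq_bitParity 2 (by norm_num)]; rfl]
  simp

theorem t_four_mul_two_pow_add {c x : ℕ} (hx : x < 2 ^ c) : t (4 * 2 ^ c + x) = !t x := by
  rw [t_mul_two_pow_add _ _ _ hx, show t 4 = true by rw [t_eq_bitParity 3 (by norm_num)]; rfl]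
  simp

/-- The prefix of length `k * (3 * 2 ^ c + 1)` is a `k`-antipower for `k` almost as large as
`10 / 3 * 2 ^ c`. -/
theorem three_mul_two_pow_add_one_mem_F {c k : ℕ} (hc : 2 ≤ c) (hk : 3 * k + 3 ≤ 10 * 2 ^ c) :
    3 * 2 ^ c + 1 ∈ F k := by
  have hw : 2 ^ c = 4 * 2 ^ (c - 2) := by
    rw [show (4 : ℕ) = 2 ^ 2 by norm_num, ← pow_add]; congr 1; omega
  have hodd : Odd (3 * 2 ^ c + 1) := by rw [Nat.odd_iff]; omega
  refine mem_F_iff.mpr ⟨hodd, fun i j hij hj hB => ?_⟩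
  obtain ⟨d, hd⟩ := two_pow_dvd_of_blockEq (s := c) hodd (by omega) hij.le hB
  have hK : 2 ^ (c + 1) = 2 * 2 ^ c := by ring
  have hpos : 0 < 2 ^ (c - 2) := by positivity
  have hd1 : d = 1 := by
    rcases Nat.lt_or_ge d 2 with h | h
    · interval_cases d
      · omega
      · rfl
    · have : 2 ^ (c + 1) * 2 ≤ 2 ^ (c + 1) * d := Nat.mul_le_mul_left _ h
      omega
  obtain rfl : j = i + 2 ^ (c + 1) := by rw [hd1] at hd; omega
  set N := 2 ^ c with hN
  set a := i * (3 * N + 1) / 2 ^ (c + 1) with ha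
  have h1 : 2 ^ (c + 1) * a ≤ i * (3 * N + 1) := Nat.mul_div_le _ _
  have h2 : i * (3 * N + 1) < 2 ^ (c + 1) * (a + 1) := Nat.lt_mul_div_succ _ (by positivity)
  have f0 : t a = t (a + (3 * N + 1)) := cell_eq_of_blockEq hB h2 (by omega)
  have f1 : t (a + 1) = t (a + 1 + (3 * N + 1)) :=
    cell_eq_of_blockEq hB (by rw [mul_add _ (a + 1)]; omega) (by rw [mul_add]; omega)
  -- As `3 * i < 4 * N`, this keeps `a + 2` below `2 * N`; hence the `10 / 3`. Away from the carry,
  -- adding `3 * N + 1` acts as a shift by one, and two agreements make a cube.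
  have hle : 2 * a < 3 * i + 2 := by
    refine Nat.lt_of_mul_lt_mul_left (a := N) ?_
    rw [hK] at h1
    have : i < 2 * N := by omega
    nlinarith
  clear ha h1 h2 hB hd
  clear_value a
  rcases lt_or_ge (a + 2) N with hlt | hge
  · rw [show a + (3 * N + 1) = 3 * 2 ^ c + (a + 1) by omega,
      t_three_mul_two_pow_add (by omega)] at f0
    rw [show a + 1 + (3 * N + 1) = 3 * 2 ^ c + (a + 2) by omega,
      t_three_mul_two_pow_add (by omega)] at f1
    exact t_not_cube a ⟨f0, f1⟩
  rcases lt_or_ge a N with hlt | hge'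
  · obtain rfl | rfl : a = N - 2 ∨ a = N - 1 := by omega
    · rw [show N - 2 + (3 * N + 1) = 3 * 2 ^ c + (2 * (2 * 2 ^ (c - 2) - 1) + 1) by omega,
        t_three_mul_two_pow_add (by omega),
        show N - 2 = 2 * (2 * 2 ^ (c - 2) - 1) by omega] at f0
      exact t_ne_succ _ f0
    · rw [show N - 1 + 1 + (3 * N + 1) = 4 * 2 ^ c + 1 by omega,
        t_four_mul_two_pow_add (by omega), show N - 1 + 1 = 2 ^ c + 0 by omega,
        t_two_pow_add (by omega)] at f1
      exact absurd f1 (by decide)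
  · obtain ⟨b, rfl⟩ := Nat.exists_eq_add_of_le hge'
    rw [show N + b + (3 * N + 1) = 4 * 2 ^ c + (b + 1) by omega,
      t_four_mul_two_pow_add (by omega), t_two_pow_add (by omega)] at f0
    rw [show N + b + 1 + (3 * N + 1) = 4 * 2 ^ c + (b + 2) by omega,
      t_four_mul_two_pow_add (by omega), add_assoc, t_two_pow_add (by omega)] at f1
    exact t_not_cube b ⟨by simpa using f0, by simpa using f1⟩

theorem three_mul_two_pow_sub_one_no_pair {r m a : ℕ} (hr : 2 ≤ r) (hm : m + 1 = 3 * 2 ^ r)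
    (ha : a + 2 < 2 * 2 ^ r) (f0 : t a = t (a + m)) (f1 : t (a + 1) = t (a + 1 + m)) : False := by
  have hw : 2 ^ r = 4 * 2 ^ (r - 2) := by
    rw [show (4 : ℕ) = 2 ^ 2 by norm_num, ← pow_add]; congr 1; omega
  have hpos : 0 < 2 ^ (r - 2) := by positivity
  rcases Nat.eq_zero_or_pos a with rfl | ha0
  · rw [show 0 + 1 + m = 3 * 2 ^ r + 0 by omega, t_three_mul_two_pow_add (by omega)] at f1
    exact absurd f1 (by decide)
  obtain ⟨b, rfl⟩ := Nat.exists_eq_add_of_le' ha0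
  rcases lt_or_ge (b + 2) (2 ^ r) with hlt | hge
  · rw [show b + 1 + m = 3 * 2 ^ r + b by omega, t_three_mul_two_pow_add (by omega)] at f0
    rw [show b + 1 + 1 + m = 3 * 2 ^ r + (b + 1) by omega,
      t_three_mul_two_pow_add (by omega)] at f1
    exact t_not_cube b ⟨f0.symm, f1.symm⟩
  obtain h | h | h : b + 2 = 2 ^ r ∨ b + 1 = 2 ^ r ∨ 2 ^ r ≤ b := by omega
  · rw [show b + 1 + m = 3 * 2 ^ r + 2 * (2 * 2 ^ (r - 2) - 1) by omega,
      t_three_mul_two_pow_add (by omega),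
      show b + 1 = 2 * (2 * 2 ^ (r - 2) - 1) + 1 by omega] at f0
    exact t_ne_succ _ f0.symm
  · rw [show b + 1 + 1 + m = 4 * 2 ^ r + 0 by omega, t_four_mul_two_pow_add (by omega), h,
      t_two_pow_add (by omega)] at f1
    exact absurd f1 (by decide)
  · obtain ⟨d, rfl⟩ := Nat.exists_eq_add_of_le h
    rw [show 2 ^ r + d + 1 + m = 4 * 2 ^ r + d by omega,
      t_four_mul_two_pow_add (by omega), add_assoc, t_two_pow_add (by omega)] at f0
    rw [show 2 ^ r + d + 1 + 1 + m = 4 * 2 ^ r + (d + 1) by omega,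
      t_four_mul_two_pow_add (by omega), show 2 ^ r + d + 1 + 1 = 2 ^ r + (d + 2) by ring,
      t_two_pow_add (by omega)] at f1
    exact t_not_cube d ⟨by simpa using f0.symm, by simpa using f1.symm⟩

/-- Four consecutive letters of `t` never agree with those an odd number of steps later. -/
theorem not_agree_four {m a : ℕ} (hm : Odd m) (h : ∀ u < 4, t (a + u) = t (a + u + m)) :
    False := by
  have := even_add_of_eq_four (p := a) (q := a + m) fun u hu => by rw [h u hu]; congr 1; ring
  rw [Nat.odd_iff] at hm
  omega

/-- Only distances `2 ^ r` and `2 ^ (r + 1)` remain. For the first, the drift of `-i` letters makes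
most blocks meet four cells, against `not_agree_four`; for the second, adding `m` is mostly a shift
back by one. -/
theorem three_mul_two_pow_sub_one_mem_F {r m : ℕ} (hr : 2 ≤ r) (hm : m + 1 = 3 * 2 ^ r) :
    m ∈ F m := by
  have hw : 2 ^ r = 4 * 2 ^ (r - 2) := by
    rw [show (4 : ℕ) = 2 ^ 2 by norm_num, ← pow_add]; congr 1; omega
  have hpos : 0 < 2 ^ (r - 2) := by positivity
  have hodd : Odd m := by rw [Nat.odd_iff]; omega
  refine mem_F_iff.mpr ⟨hodd, fun i j hij hj hB => ?_⟩
  have hr1 : 2 ^ r = 2 * 2 ^ (r - 1) := by rw [← pow_succ']; congr 1; omega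
  obtain ⟨d, hd⟩ := two_pow_dvd_of_blockEq (s := r - 1) hodd (by omega) hij.le hB
  rw [Nat.sub_add_cancel (by omega)] at hd
  have him : i * m + i = 3 * (i * 2 ^ r) := by
    rw [show i * m + i = i * (m + 1) by ring, hm]; ring
  have hd3 : d < 3 := by
    by_contra! h
    have : 2 ^ r * 3 ≤ 2 ^ r * d := Nat.mul_le_mul_left _ h
    omega
  have hd0 : d ≠ 0 := by rintro rfl; omega
  obtain rfl | rfl : d = 1 ∨ d = 2 := by omega
  · obtain rfl : j = i + 2 ^ r := by omega
    have cell : ∀ a, i * m < 2 ^ r * (a + 1) → 2 ^ r * a < i * m + m → t a = t (a + m) :=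
      fun a => cell_eq_of_blockEq hB
    set N := 2 ^ r with hN
    obtain h | h | h | h | h :
        i = 0 ∨ (0 < i ∧ i + 1 < N) ∨ i + 1 = N ∨ i = N ∨ (N < i ∧ i + 1 < 2 * N) := by omega
    · subst h
      have := cell 1 (by omega) (by omega)
      rw [show 1 + m = 3 * 2 ^ r + 0 by omega, t_three_mul_two_pow_add (by omega)] at this
      exact absurd this (by decide)
    · refine not_agree_four (a := 3 * i - 1) hodd fun u hu => ?_
      obtain ⟨i, rfl⟩ := Nat.exists_eq_add_of_le' h.1
      rw [show 3 * (i + 1) - 1 = 3 * i + 2 by omega]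
      exact cell _ (by nlinarith) (by nlinarith)
    · have := cell (3 * i + 1) (by nlinarith) (by nlinarith)
      rw [show 3 * i + 1 + m = 5 * 2 ^ r + (4 * (2 ^ (r - 2) - 1) + 1) by omega,
        show 3 * i + 1 = 2 * 2 ^ r + (4 * (2 ^ (r - 2) - 1) + 2) by omega,
        t_mul_two_pow_add _ _ _ (by omega), t_mul_two_pow_add _ _ _ (by omega),
        t_four_mul_add _ _ (by norm_num), t_four_mul_add _ _ (by norm_num),
        t_eq_bitParity 3 (by norm_num : 5 < 2 ^ 3), t_eq_bitParity 3 (by norm_num : 2 < 2 ^ 3)] at this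
      revert this
      generalize t (2 ^ (r - 2) - 1) = x
      revert x; decide
    · have := cell (3 * i + 1) (by rw [h] at him ⊢; nlinarith) (by rw [h] at him ⊢; nlinarith)
      rw [show 3 * i + 1 + m = 6 * 2 ^ r + 0 by omega,
        show 3 * i + 1 = 3 * 2 ^ r + 1 by omega,
        t_mul_two_pow_add _ _ _ (by omega), t_mul_two_pow_add _ _ _ (by omega),
        t_eq_bitParity 3 (by norm_num : 6 < 2 ^ 3), t_eq_bitParity 3 (by norm_num : 3 < 2 ^ 3)] at this
      exact absurd this (by decide)
    · refine not_agree_four (a := 3 * i - 2) hodd fun u hu => ?_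
      obtain ⟨i, rfl⟩ := Nat.exists_eq_add_of_le' (show 1 ≤ i by omega)
      rw [show 3 * (i + 1) - 2 = 3 * i + 1 by omega]
      exact cell _ (by nlinarith) (by nlinarith)
  · have hK : 2 ^ (r + 1) = 2 * 2 ^ r := by ring
    obtain rfl : j = i + 2 ^ (r + 1) := by omega
    set a := i * m / 2 ^ (r + 1) with ha
    have h1 : 2 ^ (r + 1) * a ≤ i * m := Nat.mul_div_le _ _
    have h2 : i * m < 2 ^ (r + 1) * (a + 1) := Nat.lt_mul_div_succ _ (by positivity)
    refine three_mul_two_pow_sub_one_no_pair (a := a) hr hm ?_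
      (cell_eq_of_blockEq hB h2 (by omega))
      (cell_eq_of_blockEq hB (by rw [mul_add _ (a + 1)]; omega) (by rw [mul_add]; omega))
    have : 2 * a ≤ 3 * i := by
      refine le_of_mul_le_mul_left (a := 2 ^ r) ?_ (by positivity)
      rw [hK] at h1
      nlinarith
    omega

/-- Letters at distance `3`: two consecutive positions starting with an even one do not both
carry different letters. -/
theorem not_ne_add_three (b : ℕ) :
    ¬ (t (2 * b) ≠ t (2 * b + 3) ∧ t (2 * b + 1) ≠ t (2 * b + 4)) := by
  rintro ⟨h1, h2⟩
  rw [show 2 * b + 3 = 2 * (b + 1) + 1 by ring, t_two_mul, t_two_mul_add_one] at h1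
  rw [show 2 * b + 4 = 2 * (b + 2) by ring, t_two_mul, t_two_mul_add_one] at h2
  apply t_not_cube b
  revert h1 h2
  generalize t b = x; generalize t (b + 1) = y; generalize t (b + 2) = z
  revert x y z; decide

/-- Every block meets three cells of length `2 ^ k`. Below the carry, agreement means different
letters at distance 3, which `not_ne_add_three` excludes for one of the two adjacent pairs. -/
theorem two_pow_add_three_mem_F {k m : ℕ} (hk : 3 ≤ k) (hm : m = 2 ^ (k + 1) + 3) :
    m ∈ F (2 ^ (k + 1)) := by
  have hw : 2 ^ k = 8 * 2 ^ (k - 3) := by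
    rw [show (8 : ℕ) = 2 ^ 3 by norm_num, ← pow_add]; congr 1; omega
  have hpos : 0 < 2 ^ (k - 3) := by positivity
  have hK : 2 ^ (k + 1) = 2 * 2 ^ k := by ring
  have hodd : Odd m := by rw [Nat.odd_iff]; omega
  refine mem_F_iff.mpr ⟨hodd, fun i j hij hj hB => ?_⟩
  have hr1 : 2 ^ k = 2 * 2 ^ (k - 1) := by rw [← pow_succ']; congr 1; omega
  obtain ⟨d, hd⟩ := two_pow_dvd_of_blockEq (s := k - 1) hodd (by omega) hij.le hB
  rw [Nat.sub_add_cancel (by omega)] at hd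
  have hd3 : d < 2 := by
    by_contra! h
    have : 2 ^ k * 2 ≤ 2 ^ k * d := Nat.mul_le_mul_left _ h
    omega
  have hd0 : d ≠ 0 := by rintro rfl; omega
  obtain rfl : d = 1 := by omega
  obtain rfl : j = i + 2 ^ k := by omega
  have him : i * m = 2 * (i * 2 ^ k) + 3 * i := by rw [hm, hK]; ring
  set a := i * m / 2 ^ k with ha
  have h1 : 2 ^ k * a ≤ i * m := Nat.mul_div_le _ _
  have h2 : i * m < 2 ^ k * (a + 1) := Nat.lt_mul_div_succ _ (by positivity)
  have cell : ∀ u < 3, t (a + u) = t (a + u + m) := by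
    intro u hu
    refine cell_eq_of_blockEq hB (h2.trans_le (Nat.mul_le_mul_left _ (by omega))) ?_
    rw [mul_add]
    have : 2 ^ k * u ≤ 2 ^ k * 2 := Nat.mul_le_mul_left _ (by omega)
    omega
  have hle : a ≤ 2 * i + 2 := by
    refine Nat.lt_succ_iff.mp (Nat.lt_of_mul_lt_mul_left (a := 2 ^ k) ?_)
    nlinarith
  -- The drift `3 * i` carries block `2 ^ k - 1` past this cell.
  have hne : a + 1 ≠ 2 ^ (k + 1) := by
    intro h
    have : 2 * i + 1 = a := by omega
    have hi : i + 1 = 2 ^ k := by omega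
    have : 2 ^ k * (a + 1) = 2 * (i * 2 ^ k) + 2 * 2 ^ k := by rw [← this]; ring
    omega
  have c0 := cell 0 (by norm_num)
  have c1 := cell 1 (by norm_num)
  have c2 := cell 2 (by norm_num)
  clear ha h1 h2 him cell hB hd
  clear_value a
  rw [add_zero] at c0
  have inner : ∀ x, x + 3 < 2 ^ (k + 1) → t x = t (x + m) → t x ≠ t (x + 3) := by
    intro x hx h
    rw [show x + m = 2 ^ (k + 1) + (x + 3) by omega, t_two_pow_add hx] at h
    rw [h]; simp
  have outer : ∀ x, x < 2 ^ (k + 1) → t (2 * 2 ^ (k + 1) + x) = !t x := by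
    intro x hx
    rw [t_mul_two_pow_add _ _ _ hx, show t 2 = true by rw [t_eq_bitParity 2 (by norm_num)]; rfl]
    simp
  set w := 4 * 2 ^ (k - 3) - 1 with hw'
  have q4 : t (4 * w) ≠ t (4 * w + m) := by
    rw [show 4 * w + m = 2 ^ (k + 1) + (4 * w + 3) by omega, t_two_pow_add (by omega),
      t_four_mul_add _ _ (by norm_num), show t (4 * w) = _ from t_four_mul_add w 0 (by norm_num)]
    generalize t w = x; revert x; decide
  have q3 : t (4 * w + 1) = t (4 * w + 1 + m) → t w = false := by
    rw [show 4 * w + 1 + m = 2 * 2 ^ (k + 1) + 0 by omega, outer _ (by positivity),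
      t_four_mul_add _ _ (by norm_num), t_zero]
    generalize t w = x; revert x; decide
  have q2 : t (4 * w + 2) = t (4 * w + 2 + m) → t w = true := by
    rw [show 4 * w + 2 + m = 2 * 2 ^ (k + 1) + 1 by omega, outer _ (by omega),
      t_four_mul_add _ _ (by norm_num), t_one]
    generalize t w = x; revert x; decide
  have q1 : t (4 * w + 3) = t (4 * w + 3 + m) → t w = false := by
    rw [show 4 * w + 3 + m = 2 * 2 ^ (k + 1) + 2 by omega, outer _ (by omega),
      t_four_mul_add _ _ (by norm_num), show t 2 = true by rw [t_eq_bitParity 2 (by norm_num)]; rfl]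
    generalize t w = x; revert x; decide
  obtain h | h | h | h | h | h | h : a + 5 < 2 ^ (k + 1) ∨ a + 1 = 4 * w ∨ a + 2 = 4 * w ∨
      a = 4 * w ∨ a = 4 * w + 1 ∨ a = 4 * w + 2 ∨ a = 2 ^ (k + 1) := by omega
  · have e0 := inner _ (by omega) c0
    have e1 := inner _ (by omega) c1
    have e2 := inner _ (by omega) c2
    rcases Nat.even_or_odd' a with ⟨b, rfl | rfl⟩
    · exact not_ne_add_three b ⟨e0, e1⟩
    · exact not_ne_add_three (b + 1) ⟨e1, e2⟩
  · rw [h] at c1; exact q4 c1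
  · rw [h] at c2; exact q4 c2
  · rw [h] at c0; exact q4 c0
  · rw [h] at c0 c1
    have := q3 c0
    rw [q2 c1] at this
    exact absurd this (by decide)
  · rw [h] at c0 c1
    have := q1 c1
    rw [q2 c0] at this
    exact absurd this (by decide)
  · rw [h, show 2 ^ (k + 1) + 2 + m = 2 * 2 ^ (k + 1) + 5 by omega, outer _ (by omega),
      t_two_pow_add (by omega), t_eq_bitParity 3 (by norm_num : 2 < 2 ^ 3),
      t_eq_bitParity 3 (by norm_num : 5 < 2 ^ 3)] at c2
    exact absurd c2 (by decide)

theorem two_pow_sub_three_mem_F {n m : ℕ} (hm : m + 3 = 2 ^ (2 * n + 6)) :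
    m ∈ F (2 ^ (2 * n + 6) + 6) := by
  set K := 2 ^ (2 * n + 6) with hKdef
  set N := 2 ^ (2 * n + 5) with hN
  set w := 2 ^ (2 * n + 4) - 1 with hw
  have hpos : 0 < 2 ^ (2 * n) := by positivity
  have hN32 : N = 32 * 2 ^ (2 * n) := by rw [hN, pow_add]; ring
  have hK : K = 2 * N := by rw [hKdef, hN, pow_succ]; ring
  have hw4 : 4 * w + 4 = K := by
    have : 2 ^ (2 * n + 4) = 16 * 2 ^ (2 * n) := by rw [pow_add]; ring
    omega
  have htw : t w = false := by
    rw [hw, t_two_pow_sub_one, show (2 * n + 4) % 2 = 0 by omega]; rfl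
  have t4w : ∀ r < 4, t (4 * w + r) = bitParity 2 r := fun r hr => by
    rw [t_four_mul_add _ _ hr, htw]; simp
  have tK : ∀ x < K, t (K + x) = !t x := fun x hx => t_two_pow_add hx
  have t2K : ∀ x < K, t (2 * K + x) = !t x := fun x hx => by
    rw [hKdef, t_mul_two_pow_add _ _ _ hx,
      show t 2 = true by rw [t_eq_bitParity 2 (by norm_num)]; rfl]
    simp
  have t8 : ∀ x < 16, t x = bitParity 4 x := fun x hx => t_eq_bitParity 4 hx
  have hodd : Odd m := by rw [Nat.odd_iff]; omega
  have hN1 : N = 2 * 2 ^ (2 * n + 4) := by rw [hN, pow_succ]; ring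
  -- cells that disagree with those `m` steps later
  have f0 : t 0 ≠ t (0 + m) := by
    rw [show 0 + m = 4 * w + 1 by omega, t4w _ (by norm_num), t_zero]; decide
  have f2 : t 2 ≠ t (2 + m) := by
    rw [show 2 + m = 4 * w + 3 by omega, t4w _ (by norm_num), t8 _ (by norm_num)]; decide
  have f3 : t 3 ≠ t (3 + m) := by
    rw [show 3 + m = K + 0 by omega, tK _ (by omega), t8 _ (by norm_num), t_zero]; decide
  have f4 : t 4 ≠ t (4 + m) := by
    rw [show 4 + m = K + 1 by omega, tK _ (by omega), t8 _ (by norm_num), t_one]; decide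
  have inner : ∀ x, x + 3 < K → t (x + 3) = t (x + 3 + m) → t x ≠ t (x + 3) := by
    intro x hx h
    rw [show x + 3 + m = K + x by omega, tK _ (by omega)] at h
    rw [h]; simp
  have pair : ∀ b, 2 * b + 4 < K → ¬ (t (2 * b + 3) = t (2 * b + 3 + m) ∧
      t (2 * b + 4) = t (2 * b + 4 + m)) := fun b hb h =>
    not_ne_add_three b ⟨inner _ (by omega) h.1, inner (2 * b + 1) (by omega) h.2⟩
  refine mem_F_iff.mpr ⟨hodd, fun i j hij hj hB => ?_⟩
  obtain ⟨d, hd⟩ := two_pow_dvd_of_blockEq (s := 2 * n + 4) hodd (by omega) hij.le hB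
  rw [← hN] at hd
  have hd3 : d < 3 := by
    by_contra! h
    have : N * 3 ≤ N * d := Nat.mul_le_mul_left _ h
    omega
  have hd0 : d ≠ 0 := by rintro rfl; omega
  have him : i * m + 3 * i = 2 * (i * N) := by
    rw [show i * m + 3 * i = i * (m + 3) by ring, hm, hK]; ring
  obtain rfl | rfl : d = 2 ∨ d = 1 := by omega
  · obtain rfl : j = i + 2 ^ (2 * n + 6) := by omega
    have cell : ∀ a, i * m < K * (a + 1) → K * a < i * m + m → t a = t (a + m) :=
      fun a => cell_eq_of_blockEq hB
    have hi : i < 6 := by omega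
    interval_cases i
    · exact f0 (cell 0 (by omega) (by omega))
    · exact f0 (cell 0 (by omega) (by omega))
    · exact f2 (cell 2 (by omega) (by omega))
    · exact f2 (cell 2 (by omega) (by omega))
    · exact f3 (cell 3 (by omega) (by omega))
    · exact f4 (cell 4 (by omega) (by omega))
  · obtain rfl : j = i + 2 ^ (2 * n + 5) := by omega
    have cell : ∀ a, i * m < N * (a + 1) → N * a < i * m + m → t a = t (a + m) :=
      fun a => cell_eq_of_blockEq hB
    rcases lt_or_ge i 2 with hi2 | hi2
    · interval_cases i
      · exact f0 (cell 0 (by omega) (by omega))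
      · exact f2 (cell 2 (by omega) (by omega))
    rcases lt_or_ge N i with hiN | hiN
    · obtain ⟨x, rfl⟩ := Nat.exists_eq_add_of_lt hiN
      have hx : x < 5 := by omega
      have him' : (N + x + 1) * m = N * (K + 2 * x + 2) - 3 * (N + x + 1) := by
        have : N * (K + 2 * x + 2) = 2 * ((N + x + 1) * N) := by rw [hK]; ring
        omega
      have hNK : N * (K + 2 * x + 2) = N * K + 2 * (N * x) + 2 * N := by ring
      have met : ∀ y, 2 * x ≤ y + 2 → y ≤ 2 * x →
          t (K + y) = t (K + y + m) := by
        intro y h1 h2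
        refine cell _ ?_ ?_
        · rw [him', hNK, show N * (K + y + 1) = N * K + N * y + N by ring]
          have : N * (2 * x) ≤ N * (y + 2) := Nat.mul_le_mul_left _ h1
          have e1 : N * (2 * x) = 2 * (N * x) := by ring
          have e2 : N * (y + 2) = N * y + 2 * N := by ring
          omega
        · rw [him', hNK, mul_add]
          have : N * y ≤ N * (2 * x) := Nat.mul_le_mul_left _ h2
          have e1 : N * (2 * x) = 2 * (N * x) := by ring
          omega
      interval_cases x
      · have := cell (4 * w + 3) (by rw [him', hNK, show 4 * w + 3 + 1 = K by omega]; omega)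
          (by rw [him', hNK, show 4 * w + 3 = K - 1 by omega, Nat.mul_sub]
              have : N * 1 ≤ N * K := Nat.mul_le_mul_left _ (by omega)
              omega)
        rw [show 4 * w + 3 + m = K + (4 * w + 0) by omega, tK _ (by omega), t4w _ (by norm_num),
          t4w _ (by norm_num)] at this
        exact absurd this (by decide)
      · have := met 0 (by norm_num) (by norm_num)
        rw [show K + 0 + m = K + (4 * w + 1) by omega, tK _ (by omega), tK _ (by omega),
          t4w _ (by norm_num), t_zero] at this
        exact absurd this (by decide)
      · have := met 2 (by norm_num) (by norm_num)
        rw [show K + 2 + m = K + (4 * w + 3) by omega, tK _ (by omega), tK _ (by omega),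
          t4w _ (by norm_num), t8 _ (by norm_num)] at this
        exact absurd this (by decide)
      · have := met 5 (by norm_num) (by norm_num)
        rw [show K + 5 + m = 2 * K + 2 by omega, tK _ (by omega), t2K _ (by omega),
          t8 _ (by norm_num), t8 _ (by norm_num)] at this
        exact absurd this (by decide)
      · have := met 8 (by norm_num) (by norm_num)
        rw [show K + 8 + m = 2 * K + 5 by omega, tK _ (by omega), t2K _ (by omega),
          t8 _ (by norm_num), t8 _ (by norm_num)] at this
        exact absurd this (by decide)
    · obtain ⟨x, rfl⟩ := Nat.exists_eq_add_of_le' hi2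
      have hxN : (x + 2) * N = N * x + 2 * N := by ring
      have e1 : N * (2 * x + 1) = 2 * (N * x) + N := by ring
      have e6 : N * (2 * x + 4) = 2 * (N * x) + 4 * N := by ring
      have e2 : N * (2 * x + 2) = 2 * (N * x) + 2 * N := by ring
      have e3 : N * (2 * x + 3) = 2 * (N * x) + 3 * N := by ring
      have e4 : N * (2 * x + 3 + 1) = 2 * (N * x) + 4 * N := by ring
      have e5 : N * (2 * x + 4 + 1) = 2 * (N * x) + 5 * N := by ring
      rw [hxN] at him
      -- Block `x + 2` runs from `N * (2 * x + 4) - (3 * x + 6)` to `N * (2 * x + 6) - (3 * x + 9)`.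
      -- The first two cases provide a pair of cells of the right parity; the last reduces modulo 3
      -- to a single `x`.
      obtain h | h | h : 3 * x + 9 < 2 * N ∨ 2 * N < 3 * x + 6 ∨
          (2 * N ≤ 3 * x + 9 ∧ 3 * x + 6 ≤ 2 * N) := by omega
      · exact pair x (by omega) ⟨cell _ (by omega) (by omega), cell _ (by omega) (by omega)⟩
      · obtain ⟨y, rfl⟩ : ∃ y, x = y + 1 := ⟨x - 1, by omega⟩
        exact pair y (by omega) ⟨cell _ (by rw [show 2 * y + 3 + 1 = 2 * (y + 1) + 2 by ring]; omega)
          (by rw [show 2 * y + 3 = 2 * (y + 1) + 1 by ring]; omega),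
          cell _ (by rw [show 2 * y + 4 + 1 = 2 * (y + 1) + 3 by ring]; omega)
          (by rw [show 2 * y + 4 = 2 * (y + 1) + 2 by ring]; omega)⟩
      · have h3 : 2 ^ (2 * n) % 3 = 1 := by
          rw [pow_mul, Nat.pow_mod]; norm_num
        have hx : 3 * x + 7 = 2 * N := by omega
        have := cell (2 * x + 3) (by omega) (by omega)
        obtain ⟨v, hv⟩ : ∃ v, x = 16 * v + 3 := ⟨x / 16, by omega⟩
        have hne := inner (2 * x) (by omega) this
        rw [show 2 * x + 3 = v * 2 ^ 5 + 9 by omega, show 2 * x = v * 2 ^ 5 + 6 by omega,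
          t_mul_two_pow_add 5 _ _ (by norm_num), t_mul_two_pow_add 5 _ _ (by norm_num),
          t8 6 (by norm_num), t8 9 (by norm_num)] at hne
        exact hne rfl

/-! ### Bounds on `γ` and `Γ`. -/

theorem exists_two_pow_lt_le {k : ℕ} (hk : 2 ≤ k) : ∃ s, 2 ^ s < k ∧ k ≤ 2 ^ (s + 1) := by
  have h1 : 2 ^ Nat.log 2 (k - 1) ≤ k - 1 := Nat.pow_log_le_self 2 (by omega)
  have h2 : k - 1 < 2 ^ (Nat.log 2 (k - 1) + 1) := Nat.lt_pow_succ_log_self (by norm_num) _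
  exact ⟨Nat.log 2 (k - 1), by omega, by omega⟩

theorem F_nonempty (k : ℕ) : (F k).Nonempty := by
  refine ⟨3 * 2 ^ (k + 1) + 1, F_antitone (l := 2 ^ (k + 1 + 1)) ?_ (mem_F_of_lt ?_ (by omega))⟩
  · have : k + 1 + 1 < 2 ^ (k + 1 + 1) := Nat.lt_two_pow_self
    omega
  · rw [pow_succ, Nat.odd_iff]; omega

theorem isLeast_γ (k : ℕ) : IsLeast (F k) (γ k) :=
  ⟨Nat.sInf_mem (F_nonempty k), fun _ hn => Nat.sInf_le hn⟩

theorem le_of_not_mem_F {k s n : ℕ} (hk : k ≤ 2 ^ (s + 1)) (hn : Odd n) (hF : n ∉ F k) :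
    n ≤ 3 * 2 ^ s := by
  by_contra! h
  exact hF (F_antitone hk (mem_F_of_lt hn h))

theorem bddAbove_odd_diff_F (k : ℕ) : BddAbove ({n | Odd n} \ F k) := by
  refine ⟨3 * 2 ^ k, fun n hn => le_of_not_mem_F (k := k) ?_ hn.1 hn.2⟩
  have : k + 1 < 2 ^ (k + 1) := Nat.lt_two_pow_self
  omega

theorem three_not_mem_F {k : ℕ} (hk : 3 ≤ k) : 3 ∉ F k := by
  refine not_mem_F_of_blockEq (i := 0) (j := 2) (by norm_num) (by omega) fun x hx => ?_
  rw [t_eq_bitParity 4 (by omega), t_eq_bitParity 4 (by omega)]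
  revert x; decide

theorem isGreatest_Γ {k : ℕ} (hk : 3 ≤ k) : IsGreatest ({n | Odd n} \ F k) (Γ k) :=
  ⟨Nat.sSup_mem ⟨3, by decide, three_not_mem_F hk⟩ (bddAbove_odd_diff_F k),
    fun _ hn => le_csSup (bddAbove_odd_diff_F k) hn⟩

theorem le_Γ {k n : ℕ} (hn : Odd n) (hF : n ∉ F k) : n ≤ Γ k :=
  le_csSup (bddAbove_odd_diff_F k) ⟨hn, hF⟩

theorem γ_le {k n : ℕ} (hn : n ∈ F k) : γ k ≤ n := (isLeast_γ k).2 hn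

theorem Γ_le {k s : ℕ} (hk : 3 ≤ k) (hs : k ≤ 2 ^ (s + 1)) : Γ k ≤ 3 * 2 ^ s :=
  le_of_not_mem_F hs (isGreatest_Γ hk).1.1 (isGreatest_Γ hk).1.2

theorem Γ_le_three_mul {k : ℕ} (hk : 3 ≤ k) : Γ k ≤ 3 * k := by
  obtain ⟨s, h1, h2⟩ := exists_two_pow_lt_le (k := k) (by omega)
  exact (Γ_le hk h2).trans (by omega)

theorem lt_γ_of_le {C p k : ℕ} (hk : 2 ^ (p + C) + 2 ^ (p + 4) ≤ k)
    (h : ∀ m, Odd m → 2 * (m + 2 ^ p) ≤ 3 * 2 ^ (p + C) → m ∉ F (2 ^ (p + C) + 2 ^ (p + 4))) :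
    3 * 2 ^ (p + C) < 2 * (γ k + 2 ^ p) := by
  by_contra! hle
  have hmem := (isLeast_γ k).1
  exact h _ hmem.2 hle (F_antitone hk hmem)

/-! ### Asymptotic estimates. -/

theorem exists_two_pow_mul_gt {ε : ℝ} (hε : 0 < ε) (B : ℝ) : ∃ C, 3 ≤ C ∧ B ≤ ε * 2 ^ C := by
  obtain ⟨n, hn⟩ := pow_unbounded_of_one_lt (B / ε) (by norm_num : (1 : ℝ) < 2)
  refine ⟨n + 3, by omega, ?_⟩
  rw [div_lt_iff₀ hε] at hn
  have : (2 : ℝ) ^ n ≤ 2 ^ (n + 3) := pow_le_pow_right₀ (by norm_num) (by omega)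
  nlinarith

theorem eventually_le_mul {ε : ℝ} (hε : 0 < ε) (B : ℝ) : ∀ᶠ k : ℕ in atTop, B ≤ ε * k := by
  filter_upwards [eventually_ge_atTop ⌈B / ε⌉₊] with k hk
  have h1 : B / ε ≤ k := (Nat.le_ceil _).trans (by exact_mod_cast hk)
  rw [div_le_iff₀ hε] at h1
  linarith

theorem eventually_le_γ {ε : ℝ} (hε : 0 < ε) : ∀ᶠ k : ℕ in atTop, (3 / 4 - ε) * k ≤ γ k := by
  -- Twice 13 exceeds `3 / 4 * 2 * 16 + 1`, the lower-order terms in units of `2 ^ p`.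
  obtain ⟨C, hC, hCε⟩ := exists_two_pow_mul_gt hε 13
  obtain ⟨P, hP⟩ := exists_forall_not_mem_F hC
  filter_upwards [eventually_ge_atTop ((2 ^ C + 16) * 2 ^ P)] with k hk
  set X := 2 ^ C + 16 with hX
  have hX0 : 0 < X := by positivity
  set p := Nat.log 2 (k / X) with hp
  have hkX : 2 ^ P ≤ k / X := by rw [Nat.le_div_iff_mul_le hX0, mul_comm]; exact hk
  have hkX0 : k / X ≠ 0 := by
    have : 0 < 2 ^ P := by positivity
    omega
  have hPp : P ≤ p := Nat.le_log_of_pow_le (by norm_num) hkX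
  have h1 : X * 2 ^ p ≤ k := by
    have := Nat.pow_log_le_self 2 hkX0
    rw [Nat.le_div_iff_mul_le hX0] at this
    rwa [mul_comm]
  have h2 : k < X * 2 ^ (p + 1) := by
    have := Nat.lt_pow_succ_log_self (b := 2) (by norm_num) (k / X)
    rw [Nat.div_lt_iff_lt_mul hX0] at this
    rwa [mul_comm]
  have h3 := lt_γ_of_le (C := C) (p := p) (k := k) (le_trans (le_of_eq (by rw [hX]; ring)) h1)
    (hP p hPp)
  have h3' : (3 : ℝ) * 2 ^ (p + C) ≤ 2 * (γ k + 2 ^ p) := by exact_mod_cast h3.le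
  have h2' : (k : ℝ) ≤ (2 ^ C + 16) * 2 ^ (p + 1) := by exact_mod_cast h2.le
  rw [pow_add] at h3'
  rw [pow_succ] at h2'
  have hp0 : (0 : ℝ) < 2 ^ p := by positivity
  rcases le_or_gt (3 / 4 - ε) 0 with hneg | hpos
  · exact le_trans (mul_nonpos_of_nonpos_of_nonneg hneg (by positivity)) (by positivity)
  · have := mul_le_mul_of_nonneg_left h2' hpos.le
    have h5 : 13 * (2 : ℝ) ^ p ≤ ε * 2 ^ C * 2 ^ p := by gcongr
    have h6 : 0 < ε * 2 ^ p := by positivity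
    nlinarith

theorem frequently_le_γ {ε : ℝ} (hε : 0 < ε) : ∃ᶠ k : ℕ in atTop, (3 / 2 - ε) * k ≤ γ k := by
  obtain ⟨C, hC, hCε⟩ := exists_two_pow_mul_gt hε 25
  obtain ⟨P, hP⟩ := exists_forall_not_mem_F hC
  rw [frequently_atTop]
  intro a
  refine ⟨2 ^ (P + a + C) + 2 ^ (P + a + 4), ?_, ?_⟩
  · have : P + a + C < 2 ^ (P + a + C) := Nat.lt_two_pow_self
    exact le_trans (by omega) (Nat.le_add_right _ _)
  have h3 := lt_γ_of_le le_rfl (hP (P + a) (by omega))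
  set k := 2 ^ (P + a + C) + 2 ^ (P + a + 4) with hk
  have h3' : (3 : ℝ) * 2 ^ (P + a + C) ≤ 2 * (γ k + 2 ^ (P + a)) := by exact_mod_cast h3.le
  have hk' : (k : ℝ) = 2 ^ (P + a) * (2 ^ C + 16) := by rw [hk]; push_cast; ring
  rw [hk']
  rw [pow_add] at h3'
  have hp0 : (0 : ℝ) < 2 ^ (P + a) := by positivity
  have h5 : 25 * (2 : ℝ) ^ (P + a) ≤ ε * 2 ^ C * 2 ^ (P + a) := by gcongr
  have h6 : 0 < ε * 2 ^ (P + a) := by positivity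
  nlinarith

theorem frequently_γ_le {ε : ℝ} (hε : 0 < ε) : ∃ᶠ k : ℕ in atTop, γ k ≤ (9 / 10 + ε) * k := by
  rw [frequently_atTop]
  intro a
  obtain ⟨b, hb⟩ := eventually_atTop.mp (eventually_le_mul hε (5 / 2))
  set c := a + b + 2 with hc
  have hlt : c < 2 ^ c := Nat.lt_two_pow_self
  set k := (10 * 2 ^ c - 3) / 3 with hk
  have h1 : 3 * k + 3 ≤ 10 * 2 ^ c := by omega
  have h2 : 10 * 2 ^ c ≤ 3 * k + 5 := by omega
  refine ⟨k, by omega, ?_⟩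
  have h3 : (γ k : ℝ) ≤ 3 * 2 ^ c + 1 := by
    exact_mod_cast γ_le (three_mul_two_pow_add_one_mem_F (by omega) h1)
  have h4 : (10 : ℝ) * 2 ^ c ≤ 3 * k + 5 := by exact_mod_cast h2
  have h5 := hb k (by omega)
  linarith

theorem γ_le_of_lt {k r : ℕ} (hr : 2 ≤ r) (hk : k < 3 * 2 ^ r) : γ k + 1 ≤ 3 * 2 ^ r := by
  have := γ_le (F_antitone (k := k) (by omega) (three_mul_two_pow_sub_one_mem_F (r := r)
    (m := 3 * 2 ^ r - 1) hr (by omega)))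
  omega

theorem γ_le_of_le {k j : ℕ} (hj : 3 ≤ j) (hk : k ≤ 2 ^ (j + 1)) : γ k ≤ 2 ^ (j + 1) + 3 :=
  γ_le (F_antitone hk (two_pow_add_three_mem_F hj rfl))

theorem two_mul_γ_le {k : ℕ} (hk : 2 ^ 6 ≤ k) : 2 * γ k ≤ 3 * k := by
  obtain ⟨s, h1, h2⟩ := exists_two_pow_lt_le (k := k) (by omega)
  have hs : 6 ≤ s + 1 := (Nat.pow_le_pow_iff_right (a := 2) (by norm_num)).mp (hk.trans h2)
  obtain ⟨r, rfl⟩ : ∃ r, s = r + 1 := ⟨s - 1, by omega⟩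
  rw [pow_succ] at h1
  rcases lt_or_ge k (3 * 2 ^ r) with h | h
  · have := γ_le_of_lt (by omega) h
    omega
  · have := γ_le_of_le (by omega) h2
    rw [pow_succ, pow_succ] at this
    omega

theorem two_pow_le_Γ {j k : ℕ} (hj : 3 ≤ j) (hk : 2 ^ j < k) : 2 ^ (j + 1) ≤ Γ k + 5 := by
  have h8 : 2 ^ 3 ≤ 2 ^ j := Nat.pow_le_pow_right (by norm_num) hj
  have hs : 2 ^ (j + 1) = 2 * 2 ^ j := by ring
  have he : 2 ^ j = 2 * 2 ^ (j - 1) := by rw [← pow_succ']; congr 1; omega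
  rcases Nat.mod_two_eq_zero_or_one j with h | h
  · have := le_Γ (k := k) (n := 2 ^ (j + 1) - 5) (by rw [Nat.odd_iff]; omega) fun hF =>
      two_pow_not_mem_F hj (Or.inr ⟨by omega, h⟩) (F_antitone hk hF)
    omega
  · have := le_Γ (k := k) (n := 2 ^ (j + 1) - 1) (by rw [Nat.odd_iff]; omega) fun hF =>
      two_pow_not_mem_F hj (Or.inl ⟨by omega, h⟩) (F_antitone hk hF)
    omega

theorem three_mul_two_pow_le_Γ {p s k : ℕ} (hs : 4 ≤ s) (hs2 : s % 2 = 0) (hp : s + 3 ≤ p)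
    (hk : 2 ^ (p + s) + 2 ^ (s + 1) ≤ k) : 3 * 2 ^ (p + s) ≤ Γ k + 2 ^ p + 1 := by
  have hps : 2 ^ (p + s) = 2 ^ p * 2 ^ s := pow_add _ _ _
  have hp1 : 2 ^ p = 2 * 2 ^ (p - 1) := by rw [← pow_succ']; congr 1; omega
  have hs1 : 2 ^ s = 2 * 2 ^ (s - 1) := by rw [← pow_succ']; congr 1; omega
  have hle : 2 ^ p * 1 ≤ 2 ^ p * 2 ^ s := Nat.mul_le_mul_left _ Nat.one_le_two_pow
  have hps' : 2 ^ (p + s) = 2 * (2 ^ p * 2 ^ (s - 1)) := by rw [hps, hs1]; ring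
  have hpos : 0 < 2 ^ (p - 1) := by positivity
  have := le_Γ (k := k) (n := 3 * 2 ^ (p + s) - 2 ^ p - 1) (by rw [Nat.odd_iff]; omega) fun hF =>
    three_mul_two_pow_sub_not_mem_F hs hs2 hp (by omega) (F_antitone hk hF)
  omega

/-- With `2 ^ j < k ≤ 2 ^ (j + 1)`: just above `2 ^ j` compare `2 * 2 ^ j` with `3 / 2 * 2 ^ j`, up
to `3 / 2 * 2 ^ j` compare `3 * 2 ^ j` with `3 / 2 * 2 ^ j`, and beyond that `3 * 2 ^ j` with `2 * 2
^ j`. The worst ratio `1 / 2` occurs at both ends. -/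
theorem eventually_le_sub {ε : ℝ} (hε : 0 < ε) :
    ∀ᶠ k : ℕ in atTop, (1 / 2 - ε) * k ≤ (Γ k : ℝ) - γ k := by
  obtain ⟨C, hC, hCε⟩ := exists_two_pow_mul_gt hε 2
  set s := 2 * C with hs
  have hsε : 2 ≤ ε * 2 ^ s := by
    have : (2 : ℝ) ^ C ≤ 2 ^ s := pow_le_pow_right₀ (by norm_num) (by omega)
    nlinarith
  filter_upwards [eventually_le_mul hε (2 ^ (s + 1) + 10), eventually_ge_atTop (2 ^ (2 * s + 10))]
    with k hk1 hk2
  have hk3 : 2 ^ 1 ≤ 2 ^ (2 * s + 10) := Nat.pow_le_pow_right (by norm_num) (by omega)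
  obtain ⟨j, h1, h2⟩ := exists_two_pow_lt_le (k := k) (by omega)
  have hj : 2 * s + 10 ≤ j + 1 := (Nat.pow_le_pow_iff_right (a := 2) (by norm_num)).mp (hk2.trans h2)
  obtain ⟨p, rfl⟩ : ∃ p, j = p + s := ⟨j - s, by omega⟩
  obtain ⟨r, hr⟩ : ∃ r, p + s = r + 1 := ⟨p + s - 1, by omega⟩
  have hr2 : (2 : ℝ) ^ (p + s) = 2 * 2 ^ r := by rw [hr, pow_succ]; ring
  have hr3 : 2 ^ (p + s) = 2 * 2 ^ r := by rw [hr, pow_succ]; ring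
  have h1' : (2 : ℝ) ^ (p + s) ≤ k := by exact_mod_cast h1.le
  have h2' : (k : ℝ) ≤ 2 * 2 ^ (p + s) := by
    have : k ≤ 2 * 2 ^ (p + s) := by rw [← pow_succ']; exact h2
    exact_mod_cast this
  have hpp : (0 : ℝ) < 2 ^ p := by positivity
  have hp2 : 2 * (2 : ℝ) ^ p ≤ ε * k := by
    have e1 : 2 * (2 : ℝ) ^ p ≤ ε * 2 ^ s * 2 ^ p := by gcongr
    have e2 : ε * 2 ^ (p + s) ≤ ε * k := by gcongr
    rw [pow_add] at e2
    linarith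
  have hs0 : (0 : ℝ) < 2 ^ (s + 1) := by positivity
  rcases lt_or_ge k (2 ^ (p + s) + 2 ^ (s + 1)) with h | h
  · have h3 : (k : ℝ) ≤ 2 ^ (p + s) + 2 ^ (s + 1) := by exact_mod_cast h.le
    have h4 := two_pow_le_Γ (by omega) h1
    rw [pow_succ] at h4
    have h4' : (2 : ℝ) ^ (p + s) * 2 ≤ Γ k + 5 := by exact_mod_cast h4
    have hlt : k < 3 * 2 ^ r := by
      have : 2 ^ (s + 1) ≤ 2 ^ r := Nat.pow_le_pow_right (by norm_num) (by omega)
      omega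
    have h5 : (γ k : ℝ) + 1 ≤ 3 * 2 ^ r := by exact_mod_cast γ_le_of_lt (by omega) hlt
    linarith
  · have h4 : (3 : ℝ) * 2 ^ (p + s) ≤ Γ k + 2 ^ p + 1 := by
      exact_mod_cast three_mul_two_pow_le_Γ (by omega) (by omega) (by omega) h
    rcases lt_or_ge k (3 * 2 ^ r) with hlt | hge
    · have h5 : (γ k : ℝ) + 1 ≤ 3 * 2 ^ r := by exact_mod_cast γ_le_of_lt (by omega) hlt
      have : (k : ℝ) ≤ 3 * 2 ^ r := by exact_mod_cast hlt.le
      linarith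
    · have h5 := γ_le_of_le (by omega) h2
      rw [pow_succ] at h5
      have h5' : (γ k : ℝ) ≤ 2 ^ (p + s) * 2 + 3 := by exact_mod_cast h5
      linarith

theorem eventually_sub_le {ε : ℝ} (hε : 0 < ε) :
    ∀ᶠ k : ℕ in atTop, (Γ k : ℝ) - γ k ≤ (9 / 4 + ε) * k := by
  filter_upwards [eventually_le_γ hε, eventually_ge_atTop 3] with k h1 h2
  have : (Γ k : ℝ) ≤ 3 * k := by exact_mod_cast Γ_le_three_mul h2
  linarith

/-- At a power of two `Γ k ≤ 3 / 2 * k`, half the general bound, while `γ k` is at least about `3 /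
4 * k`. -/
theorem frequently_sub_le {ε : ℝ} (hε : 0 < ε) :
    ∃ᶠ k : ℕ in atTop, (Γ k : ℝ) - γ k ≤ (3 / 4 + ε) * k := by
  obtain ⟨b, hb⟩ := eventually_atTop.mp (eventually_le_γ hε)
  rw [frequently_atTop]
  intro a
  have hlt : a + b + 3 + 1 < 2 ^ (a + b + 3 + 1) := Nat.lt_two_pow_self
  refine ⟨2 ^ (a + b + 3 + 1), by omega, ?_⟩
  have h1 := hb (2 ^ (a + b + 3 + 1)) (by omega)
  have h2 : (Γ (2 ^ (a + b + 3 + 1)) : ℝ) ≤ 3 * 2 ^ (a + b + 3) := by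
    exact_mod_cast Γ_le (by omega) le_rfl
  set k := 2 ^ (a + b + 3 + 1) with hk
  have h3 : (k : ℝ) = 2 * 2 ^ (a + b + 3) := by rw [hk]; push_cast; ring
  linarith

theorem frequently_le_sub {ε : ℝ} (hε : 0 < ε) :
    ∃ᶠ k : ℕ in atTop, (11 / 6 - ε) * k ≤ (Γ k : ℝ) - γ k := by
  obtain ⟨b, hb⟩ := eventually_atTop.mp (eventually_le_mul hε 11)
  rw [frequently_atTop]
  intro a
  set j := 4 * (a + b) + 10 with hj
  have hlt : j < 2 ^ j := Nat.lt_two_pow_self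
  have h16 : 2 ^ 4 ≤ 2 ^ j := Nat.pow_le_pow_right (by norm_num) (by omega)
  refine ⟨2 ^ j + 6, by omega, ?_⟩
  have h1 := hb (2 ^ j + 6) (by omega)
  obtain ⟨m, hm, hF, hodd⟩ := exists_seventeen_sixths (a + b)
  have h2 := le_Γ hodd hF
  rw [← hj] at hm h2
  have hjj : 2 * (2 * (a + b) + 2) + 6 = j := by omega
  have h3 := γ_le (two_pow_sub_three_mem_F (n := 2 * (a + b) + 2) (m := 2 ^ j - 3)
    (by rw [hjj]; omega))
  rw [hjj] at h3
  have h4 : 17 * 2 ^ j ≤ 6 * Γ (2 ^ j + 6) + 2 := by omega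
  have h5 : γ (2 ^ j + 6) + 3 ≤ 2 ^ j := by omega
  have h4' : (17 : ℝ) * 2 ^ j ≤ 6 * Γ (2 ^ j + 6) + 2 := by exact_mod_cast h4
  have h5' : (γ (2 ^ j + 6) : ℝ) + 3 ≤ 2 ^ j := by exact_mod_cast h5
  push_cast at h1 ⊢
  linarith

/-! ### Epsilon criteria for limits inferior and superior. -/

theorem le_liminf_coe {f : ℕ → ℝ} {c : ℝ} (h : ∀ ε > 0, ∀ᶠ k in atTop, c - ε ≤ f k) :
    (c : EReal) ≤ liminf (fun k => (f k : EReal)) atTop := by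
  refine le_of_forall_lt fun a ha => ?_
  obtain ⟨b, hab, hbc⟩ := EReal.lt_iff_exists_real_btwn.mp ha
  refine hab.trans_le (le_liminf_of_le (by isBoundedDefault) ?_)
  filter_upwards [h (c - b) (sub_pos.mpr (by exact_mod_cast hbc))] with k hk
  exact_mod_cast (by linarith : b ≤ f k)

theorem limsup_coe_le {f : ℕ → ℝ} {c : ℝ} (h : ∀ ε > 0, ∀ᶠ k in atTop, f k ≤ c + ε) :
    limsup (fun k => (f k : EReal)) atTop ≤ (c : EReal) := by
  refine le_of_forall_gt fun a ha => ?_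
  obtain ⟨b, hcb, hba⟩ := EReal.lt_iff_exists_real_btwn.mp ha
  refine lt_of_le_of_lt (limsup_le_of_le (by isBoundedDefault) ?_) hba
  filter_upwards [h (b - c) (sub_pos.mpr (by exact_mod_cast hcb))] with k hk
  exact_mod_cast (by linarith : f k ≤ b)

theorem le_limsup_coe {f : ℕ → ℝ} {c : ℝ} (h : ∀ ε > 0, ∃ᶠ k in atTop, c - ε ≤ f k) :
    (c : EReal) ≤ limsup (fun k => (f k : EReal)) atTop := by
  refine le_of_forall_lt fun a ha => ?_
  obtain ⟨b, hab, hbc⟩ := EReal.lt_iff_exists_real_btwn.mp ha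
  refine hab.trans_le (le_limsup_of_frequently_le ?_ (by isBoundedDefault))
  refine (h (c - b) (sub_pos.mpr (by exact_mod_cast hbc))).mono fun k hk => ?_
  exact_mod_cast (by linarith : b ≤ f k)

theorem liminf_coe_le {f : ℕ → ℝ} {c : ℝ} (h : ∀ ε > 0, ∃ᶠ k in atTop, f k ≤ c + ε) :
    liminf (fun k => (f k : EReal)) atTop ≤ (c : EReal) := by
  refine le_of_forall_gt fun a ha => ?_
  obtain ⟨b, hcb, hba⟩ := EReal.lt_iff_exists_real_btwn.mp ha
  refine lt_of_le_of_lt (liminf_le_of_frequently_le ?_ (by isBoundedDefault)) hba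
  refine (h (b - c) (sub_pos.mpr (by exact_mod_cast hcb))).mono fun k hk => ?_
  exact_mod_cast (by linarith : f k ≤ b)

end ThueMorse

theorem mainTheorem1 :
    -- the minimum and the maximum that define `γ k` and `Γ k` exist
    (∀ k : ℕ, 1 ≤ k → IsLeast (ThueMorse.F k) (ThueMorse.γ k)) ∧
    (∀ k : ℕ, 3 ≤ k → IsGreatest ({n : ℕ | Odd n} \ ThueMorse.F k) (ThueMorse.Γ k)) ∧
    -- limits inferior and superior are taken in the extended reals
    (((3 / 4 : ℝ) : EReal) ≤
        liminf (fun k : ℕ => (((ThueMorse.γ k : ℝ) / (k : ℝ) : ℝ) : EReal)) atTop ∧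
      liminf (fun k : ℕ => (((ThueMorse.γ k : ℝ) / (k : ℝ) : ℝ) : EReal)) atTop ≤
        ((9 / 10 : ℝ) : EReal)) ∧
    limsup (fun k : ℕ => (((ThueMorse.γ k : ℝ) / (k : ℝ) : ℝ) : EReal)) atTop =
      ((3 / 2 : ℝ) : EReal) ∧
    (((1 / 2 : ℝ) : EReal) ≤
        liminf (fun k : ℕ =>
          ((((ThueMorse.Γ k : ℝ) - (ThueMorse.γ k : ℝ)) / (k : ℝ) : ℝ) : EReal)) atTop ∧
      liminf (fun k : ℕ =>
          ((((ThueMorse.Γ k : ℝ) - (ThueMorse.γ k : ℝ)) / (k : ℝ) : ℝ) : EReal)) atTop ≤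
        ((3 / 4 : ℝ) : EReal)) ∧
    (((11 / 6 : ℝ) : EReal) ≤
        limsup (fun k : ℕ =>
          ((((ThueMorse.Γ k : ℝ) - (ThueMorse.γ k : ℝ)) / (k : ℝ) : ℝ) : EReal)) atTop ∧
      limsup (fun k : ℕ =>
          ((((ThueMorse.Γ k : ℝ) - (ThueMorse.γ k : ℝ)) / (k : ℝ) : ℝ) : EReal)) atTop ≤
        ((9 / 4 : ℝ) : EReal)) ∧
    -- `Γ k - γ k` grows linearly in `k`
    (fun k : ℕ => (ThueMorse.Γ k : ℝ) - (ThueMorse.γ k : ℝ)) =Θ[atTop] (fun k : ℕ => (k : ℝ)) := by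
  have hpos : ∀ᶠ k : ℕ in atTop, (0 : ℝ) < k := by
    filter_upwards [eventually_gt_atTop 0] with k hk
    exact_mod_cast hk
  refine ⟨fun k _ => ThueMorse.isLeast_γ k, fun k hk => ThueMorse.isGreatest_Γ hk,
    ⟨ThueMorse.le_liminf_coe fun ε hε => ?_, ThueMorse.liminf_coe_le fun ε hε => ?_⟩,
    le_antisymm (ThueMorse.limsup_coe_le fun ε hε => ?_) (ThueMorse.le_limsup_coe fun ε hε => ?_),
    ⟨ThueMorse.le_liminf_coe fun ε hε => ?_, ThueMorse.liminf_coe_le fun ε hε => ?_⟩,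
    ⟨ThueMorse.le_limsup_coe fun ε hε => ?_, ThueMorse.limsup_coe_le fun ε hε => ?_⟩, ?_, ?_⟩
  · filter_upwards [hpos, ThueMorse.eventually_le_γ hε] with k h0 hk
    rwa [le_div_iff₀ h0]
  · refine ((ThueMorse.frequently_γ_le hε).and_eventually hpos).mono fun k hk => ?_
    rw [div_le_iff₀ hk.2]; exact hk.1
  · filter_upwards [hpos, eventually_ge_atTop (2 ^ 6)] with k h0 hk
    rw [div_le_iff₀ h0]
    have h1 : 2 * (ThueMorse.γ k : ℝ) ≤ 3 * k := by exact_mod_cast ThueMorse.two_mul_γ_le hk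
    have h2 : 0 < ε * k := by positivity
    linarith
  · refine ((ThueMorse.frequently_le_γ hε).and_eventually hpos).mono fun k hk => ?_
    rw [le_div_iff₀ hk.2]; exact hk.1
  · filter_upwards [hpos, ThueMorse.eventually_le_sub hε] with k h0 hk
    rwa [le_div_iff₀ h0]
  · refine ((ThueMorse.frequently_sub_le hε).and_eventually hpos).mono fun k hk => ?_
    rw [div_le_iff₀ hk.2]; exact hk.1
  · refine ((ThueMorse.frequently_le_sub hε).and_eventually hpos).mono fun k hk => ?_
    rw [le_div_iff₀ hk.2]; exact hk.1
  · filter_upwards [hpos, ThueMorse.eventually_sub_le hε] with k h0 hk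
    rwa [div_le_iff₀ h0]
  · refine IsBigO.of_bound 3 ?_
    filter_upwards [hpos, ThueMorse.eventually_sub_le (ε := 3 / 4) (by norm_num),
      ThueMorse.eventually_le_sub (ε := 1 / 4) (by norm_num)] with k h0 h1 h2
    rw [Real.norm_of_nonneg h0.le, Real.norm_of_nonneg (by linarith)]
    linarith
  · refine IsBigO.of_bound 4 ?_
    filter_upwards [hpos, ThueMorse.eventually_le_sub (ε := 1 / 4) (by norm_num)] with k h0 h2
    rw [Real.norm_of_nonneg h0.le, Real.norm_of_nonneg (by linarith)]
    linarith
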